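/- Let $T$ be a complete theory in a language $\mathcal L$, let $\kappa>|T|=|\mathcal L|+\aleph_0$ be a measurable cardinal, and let $M$ be the saturated model of $T$ of cardinality $\kappa$, an elementary submodel of a ($\kappa^+$-saturated) monster model $\mathbb O$. Types without further specification are global, i.e. complete types over $\mathbb O$; $x,y,z$ denote finite tuples of variables. Definitions. A global type $p(y)$ is $N$-invariant if for all $\psi(y,z)$ and all $d\equiv_N d'$ in $\mathbb O$, $\psi(y,d)\in p\iff\psi(y,d')\in p$. It is $N$-bi-invariant if it is $N$-invariant and, whenever $a\models p{\restriction}Nb$, $\operatorname{tp}(b/Na)$ extends to a global $N$-invariant type; it is strongly $N$-bi-invariant if $p^{\otimes n}$ is $N$-bi-invariant for every $n<\omega$, where $p^{\otimes n}{\restriction}B$ (for small $B\supseteq N$) is the type over $B$ of any $(a_0,\dots,a_{n-1})$ with $a_i\models p{\restriction}Ba_{<i}$. A Morley sequence over $N$ generated by $p$ is $(e_i)_{i<\omega}$ with $e_i\models p{\restriction}Ne_{<i}$, and, for $N$-invariant $p(y)\supseteq\operatorname{tp}(c/N)$, $\varphi(x,c)$ $p$-Kim-divides if $\{\varphi(x,e_i):i<\omega\}$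 is inconsistent for every such sequence. An (indexed) set of formulas is $k$-inconsistent if any $k$ distinct (distinctly indexed) members are jointly inconsistent. A dual type over $M$ is a set $\Gamma(x)$ of formulas with parameters in $M$ that is $k$-inconsistent for some $k<\omega$. A club of small elementary substructures of $M$ is a set $C$ of elementary substructures $N\preceq M$ with $|N|<\kappa$ such that every $A\subseteq M$ with $|A|<\kappa$ is contained in some $N\in C$, and the union of every nonempty chain of fewer than $\kappa$ members of $C$ is in $C$. The class of right-combs in $2^{<\omega}$ is the smallest class of sets that contains all sets with at most one element and contains $X$ whenever there is $\sigma$ such that every element of $X$ properly extends $\sigma$, $X$ has exactly one element extending $\sigma^\frown 0$, and $\{\tau\in X:\tau\trianglerighteq\sigma^\frown 1\}$ is a right-comb. $T$ has CTP (resp. ATP) if for some $k<\omega$ there are a formula $\varphi(x,y)$ and tuples $(b_\sigma)_{\sigma\in2^{<\omega}}$ in a model of $T$ such that $\{\varphi(x,b_{\eta\restriction n}):n<\omega\}$ is $k$-inconsistent for every $\eta\in2^\omega$, while $\{\varphi(x,b_\sigma):\sigma\in X\}$ is consistent for every right-comb (resp. every antichain) $X\subseteq2^{<\omega}$. Statement.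 Let $\Gamma(x)$ be a dual type over $M$ with $|\Gamma|=\kappa$ and let $C$ be a club of small elementary substructures of $M$. (1) Suppose that for every $N\in C$ there are a formula $\varphi_N(x,c_N)\in\Gamma(x)$ with $c_N\notin N$ (meaning that some parameter of $c_N$ that actually occurs in the formula lies outside $N$) and an $N$-bi-invariant type $p_N(y)\supseteq\operatorname{tp}(c_N/N)$ such that $\varphi_N(x,c_N)$ does not $p_N$-Kim-divide. Then $T$ has CTP. (2) Suppose the same with every $p_N$ strongly $N$-bi-invariant. Then $T$ has ATP. (3) Consequently, if $T$ does not have ATP (i.e. is NATP), then there is $N\in C$ such that for every formula $\varphi(x,c)\in\Gamma(x)$ with $c\notin N$ (in the same sense) and every strongly $N$-bi-invariant $p(y)\supseteq\operatorname{tp}(c/N)$, $\varphi(x,c)$ $p$-Kim-divides. -/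

import Mathlib

open FirstOrder Cardinal

universe u v w

/-- A cardinal `κ` is measurable if it is uncountable and there is a nonprincipal `κ`-complete
ultrafilter on a set of cardinality `κ`. -/
def Cardinal.IsMeasurable (κ : Cardinal.{w}) : Prop :=
  ℵ₀ < κ ∧ ∃ U : Ultrafilter κ.out,
    CardinalInterFilter (U : Filter κ.out) κ ∧ ∀ a : κ.out, U ≠ pure a

namespace FirstOrder.Language

variable {L : Language.{u, v}}

section Trees

/-! ### The binary tree `2^{<ω}`, as the set of finite lists of booleans ordered by `<+:` -/

/-- The cone above `σ`: all `τ` extending `σ` (including `σ`). -/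
def cone (σ : List Bool) : Set (List Bool) := {τ | σ <+: τ}

/-- The restriction of a path `η ∈ 2^ω` to its first `n` entries. -/
def pathRestrict (η : ℕ → Bool) (n : ℕ) : List Bool := List.ofFn fun i : Fin n => η i

/-- Right-combs in `2^{<ω}`: the smallest class of sets that contains the sets with at most one
element and contains `X` whenever, for some `σ`, `X` is contained in the cone above `σ` minus `σ`,
`X` has exactly one element above `σ⌢0`, and the part of `X` above `σ⌢1` is in the class. -/
inductive IsRightComb : Set (List Bool) → Prop
  | subsingleton (X : Set (List Bool)) (hX : X.Subsingleton) : IsRightComb X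
  | step (X : Set (List Bool)) (σ : List Bool) (hX : X ⊆ cone σ \ {σ})
      (h0 : ∃ τ, X ∩ cone (σ ++ [false]) = {τ})
      (h1 : IsRightComb (X ∩ cone (σ ++ [true]))) : IsRightComb X

end Trees

section Families

variable {M : Type*} [L.Structure M] {ι α β : Type*}

/-- In the indexed family `{φ(x, b i) : i ∈ ι}`, any `k` members (with distinct indices) are
jointly inconsistent. -/
def IsKInconsistent (φ : L.Formula (α ⊕ β)) (b : ι → β → M) (k : ℕ) : Prop :=
  ∀ F : Finset ι, F.card = k → ¬ ∃ x : α → M, ∀ i ∈ F, φ.Realize (Sum.elim x (b i))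

/-- `{φ(x, b i) : i ∈ X}` is consistent, i.e. finitely satisfiable in `M`. -/
def IsConsistentOn (φ : L.Formula (α ⊕ β)) (b : ι → β → M) (X : Set ι) : Prop :=
  ∀ F : Finset ι, (F : Set ι) ⊆ X → ∃ x : α → M, ∀ i ∈ F, φ.Realize (Sum.elim x (b i))

end Families

section TreeProperties

/-- `T` has `k`-CTP: in some model of `T` there is a binary tree of tuples `b σ` and a formula
`φ(x, y)` which is `k`-inconsistent along every path and consistent on every right-comb. -/
def Theory.HasKCTP (T : L.Theory) (k : ℕ) : Prop :=
  ∃ (𝓜 : Theory.ModelType.{u, v, max u v} T) (m n : ℕ) (φ : L.Formula (Fin m ⊕ Fin n))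
    (b : List Bool → Fin n → 𝓜),
    (∀ η : ℕ → Bool, IsKInconsistent φ (fun i => b (pathRestrict η i)) k) ∧
      ∀ X : Set (List Bool), IsRightComb X → IsConsistentOn φ b X

/-- The comb tree property. -/
def Theory.HasCTP (T : L.Theory) : Prop := ∃ k : ℕ, T.HasKCTP k

/-- `T` has `k`-ATP: in some model of `T` there is a binary tree of tuples `b σ` and a formula
`φ(x, y)` which is `k`-inconsistent along every path and consistent on every antichain. -/
def Theory.HasKATP (T : L.Theory) (k : ℕ) : Prop :=
  ∃ (𝓜 : Theory.ModelType.{u, v, max u v} T) (m n : ℕ) (φ : L.Formula (Fin m ⊕ Fin n))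
    (b : List Bool → Fin n → 𝓜),
    (∀ η : ℕ → Bool, IsKInconsistent φ (fun i => b (pathRestrict η i)) k) ∧
      ∀ X : Set (List Bool), IsAntichain (· <+: ·) X → IsConsistentOn φ b X

/-- The antichain tree property. -/
def Theory.HasATP (T : L.Theory) : Prop := ∃ k : ℕ, T.HasKATP k

end TreeProperties

section Saturation

variable (L)

/-- `M` is `μ`-saturated: for every `A ⊆ M` with `|A| < μ`, every complete type over `A` in
finitely many variables is realized in `M`. -/
def IsSaturated (μ : Cardinal.{w}) (M : Type w) [L.Structure M] [Nonempty M] : Prop :=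
  ∀ A : Set M, #A < μ → ∀ (n : ℕ) (p : (L[[A]].completeTheory M).CompleteType (Fin n)),
    p ∈ (L[[A]].completeTheory M).realizedTypes M (Fin n)

end Saturation

section Parameters

variable {α β P : Type*}

/-- `φ(x, d)`: the formula with parameters in `P` obtained from the `L`-formula `φ(x, y)` by
substituting the parameters `d` for the variables `y`. -/
def Formula.plug (φ : L.Formula (α ⊕ β)) (d : β → P) : L[[P]].Formula α :=
  BoundedFormula.constantsVarsEquiv.symm
    (Formula.relabel (Sum.elim Sum.inr (fun j => Sum.inl (d j)) : α ⊕ β → P ⊕ α) φ)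

/-- The formula `φ(x, d)` defines what it should. -/
theorem Formula.realize_plug {M : Type*} [L.Structure M] (φ : L.Formula (α ⊕ β)) (d : β → M)
    (x : α → M) : (φ.plug d).Realize x ↔ φ.Realize (Sum.elim x d) := by
  unfold Formula.plug Formula.Realize
  rw [← BoundedFormula.realize_constantsVarsEquiv]
  have h : ∀ f : L.BoundedFormula (M ⊕ α) 0, BoundedFormula.constantsVarsEquiv
      (BoundedFormula.constantsVarsEquiv.symm f) = f := fun f =>
    BoundedFormula.constantsVarsEquiv.apply_symm_apply f
  refine Iff.trans (iff_of_eq (congrArg (fun f : L.BoundedFormula (M ⊕ α) 0 =>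
    BoundedFormula.Realize f _ _) (h _))) ?_
  refine Iff.trans (Formula.realize_relabel) ?_
  unfold Formula.Realize
  refine iff_of_eq (congrArg₂ _ ?_ rfl)
  funext s
  cases s <;> rfl

/-- A set `Γ(x)` of formulas with parameters in `M` is a dual type if, for some `k`, any `k`
distinct members of it are jointly inconsistent. -/
def IsDualType {M : Type*} [L.Structure M] (Γ : Set (L[[M]].Formula α)) : Prop :=
  ∃ k : ℕ, ∀ F : Finset (L[[M]].Formula α), (F : Set (L[[M]].Formula α)) ⊆ Γ → F.card = k →
    ¬ ∃ x : α → M, ∀ θ ∈ F, θ.Realize x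

end Parameters

section GlobalTypes

variable (L) (𝕆 : Type w) [L.Structure 𝕆]

/-- A global type in the variables `α`: a complete type over the whole monster model `𝕆`. -/
abbrev GlobalType (α : Type) : Type _ := (L.elementaryDiagram 𝕆).CompleteType α

variable {L} {𝕆} {α : Type}

/-- `ψ(x, d) ∈ p(x)`. -/
def GlobalType.Holds (p : GlobalType L 𝕆 α) {k : ℕ} (ψ : L.Formula (α ⊕ Fin k))
    (d : Fin k → 𝕆) : Prop :=
  Formula.equivSentence (ψ.plug d) ∈ p

/-- `a ⊨ p ↾ B`; equivalently, `p` extends `tp(a/B)`. -/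
def GlobalType.RealizedOver (p : GlobalType L 𝕆 α) (B : Set 𝕆) (a : α → 𝕆) : Prop :=
  ∀ (k : ℕ) (ψ : L.Formula (α ⊕ Fin k)) (d : Fin k → 𝕆), (∀ j, d j ∈ B) →
    (p.Holds ψ d ↔ ψ.Realize (Sum.elim a d))

/-- `d ≡_A d'`: the tuples `d` and `d'` have the same type over `A`. -/
def SameTypeOver (A : Set 𝕆) {k : ℕ} (d d' : Fin k → 𝕆) : Prop :=
  ∀ (l : ℕ) (χ : L.Formula (Fin k ⊕ Fin l)) (a : Fin l → 𝕆), (∀ j, a j ∈ A) →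
    (χ.Realize (Sum.elim d a) ↔ χ.Realize (Sum.elim d' a))

/-- `p` is `A`-invariant: whether `ψ(x, d) ∈ p(x)` depends only on `ψ` and `tp(d/A)`. -/
def GlobalType.IsInvariant (p : GlobalType L 𝕆 α) (A : Set 𝕆) : Prop :=
  ∀ (k : ℕ) (ψ : L.Formula (α ⊕ Fin k)) (d d' : Fin k → 𝕆), SameTypeOver (L := L) A d d' →
    (p.Holds ψ d ↔ p.Holds ψ d')

/-- `p` is `A`-bi-invariant: it is `A`-invariant and whenever `a ⊨ p ↾ A b`, the type `tp(b/A a)`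
extends to a global `A`-invariant type. -/
def GlobalType.IsBiInvariant (p : GlobalType L 𝕆 α) (A : Set 𝕆) : Prop :=
  p.IsInvariant A ∧
    ∀ (a : α → 𝕆) (k : ℕ) (b : Fin k → 𝕆), p.RealizedOver (A ∪ Set.range b) a →
      ∃ r : GlobalType L 𝕆 (Fin k), r.IsInvariant A ∧ r.RealizedOver (A ∪ Set.range a) b

/-- The global type `r(x₀, …, x_{n-1})` is the power `p^{⊗n}` of the `A`-invariant global type `p`:
for every finite tuple `d`, the restriction of `r` to `A d` is the type over `A d` of any
`(a₀, …, a_{n-1})` such that `a i ⊨ p ↾ A d a₀ … a_{i-1}` for each `i < n`. -/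
def GlobalType.IsPower {n : ℕ} (r : GlobalType L 𝕆 (Fin n × α)) (p : GlobalType L 𝕆 α) (A : Set 𝕆) :
    Prop :=
  ∀ (k : ℕ) (ψ : L.Formula ((Fin n × α) ⊕ Fin k)) (d : Fin k → 𝕆),
    r.Holds ψ d ↔ ∃ a : Fin n → α → 𝕆,
      (∀ i, p.RealizedOver (A ∪ Set.range d ∪ ⋃ j < i, Set.range (a j)) (a i)) ∧
        ψ.Realize (Sum.elim (fun ij : Fin n × α => a ij.1 ij.2) d)

/-- `p` is strongly `A`-bi-invariant: `p^{⊗n}` is `A`-bi-invariant for every `n < ω`. -/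
def GlobalType.IsStronglyBiInvariant (p : GlobalType L 𝕆 α) (A : Set 𝕆) : Prop :=
  p.IsInvariant A ∧
    ∀ n : ℕ, ∃ r : GlobalType L 𝕆 (Fin n × α), r.IsPower p A ∧ r.IsBiInvariant A

/-- `(e i)_{i < ω}` is a Morley sequence over `A` generated by `p`: `e i ⊨ p ↾ A e₀ … e_{i-1}`. -/
def GlobalType.IsMorleySequence (p : GlobalType L 𝕆 α) (A : Set 𝕆) (e : ℕ → α → 𝕆) : Prop :=
  ∀ i, p.RealizedOver (A ∪ ⋃ j < i, Set.range (e j)) (e i)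

/-- `φ(x, y)` `p`-Kim-divides, for the `A`-invariant global type `p(y)`: `{φ(x, e i) : i < ω}` is
inconsistent for every Morley sequence `(e i)` over `A` generated by `p`. -/
def GlobalType.KimDivides {β : Type*} (p : GlobalType L 𝕆 α) (A : Set 𝕆)
    (φ : L.Formula (β ⊕ α)) : Prop :=
  ∀ e : ℕ → α → 𝕆, p.IsMorleySequence A e → ¬ IsConsistentOn φ e Set.univ

end GlobalTypes

section Clubs

variable {𝕆 : Type w} [L.Structure 𝕆]

/-- `C` is a club of small elementary substructures of `M` (where small means of cardinality
`< κ`, and `M` and its elementary substructures are given as elementary substructures of `𝕆`):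
it is unbounded, and closed under unions of nonempty chains of length `< κ`. -/
structure IsClubOfSmall (κ : Cardinal.{w}) (M : L.ElementarySubstructure 𝕆)
    (C : Set (L.ElementarySubstructure 𝕆)) : Prop where
  le : ∀ N ∈ C, N ≤ M
  small : ∀ N ∈ C, #N < κ
  unbounded : ∀ A : Set 𝕆, A ⊆ (M : Set 𝕆) → #A < κ → ∃ N ∈ C, A ⊆ (N : Set 𝕆)
  closed : ∀ D : Set (L.ElementarySubstructure 𝕆), D ⊆ C → D.Nonempty → IsChain (· ≤ ·) D →
    #D < κ → ∃ N ∈ C, (N : Set 𝕆) = ⋃ N' ∈ D, (N' : Set 𝕆)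

end Clubs

end FirstOrder.Language

/-!
After `ω` steps in `C` one finds `N ∈ C` such that, whenever
`φ(x, c) ∈ Γ`, the type `tp(c/N)` is finitely satisfiable in the set `P` of tuples `c'` of `N` with
`φ(x, c') ∈ Γ`. Let `W` be an ultrafilter on tuples inducing the global type `p ⊇ tp(c/N)`, and let
`V ∋ P` be one inducing a global coheir of `tp(c/N)`. Both are `N`-invariant and they agree over
`N`. A finite Morley sequence of `V` is finitely satisfiable in `P`, and is not constant in a
coordinate `c j ∉ N`, so `φ` is `k`-inconsistent along it because `Γ` is a dual type; along a Morley
sequence of `W` it is consistent because `φ(x, c)` does not `p`-Kim-divide.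

It remains to find binary trees of every finite height whose branches are Morley sequences of `V`
and whose antichains (or right-combs) are Morley sequences of `W`. From a tree `f` one gets a higher
one with halves `f` and `π ∘ f`, where `π` is elementary over `N`, and with a root realizing `V`
over both halves. Strong bi-invariance (bi-invariance) allows `π` to be chosen so that the
Morley sequences of `W` (of length one) in `f` remain Morley over the image of `π`. An antichain of
the new tree is one in `π ∘ f` followed by one in `f`, and if it is a right-comb, the latter has at
most one element.
-/

namespace MorleyTree

open FirstOrder.Language

variable {L : FirstOrder.Language.{u, v}} {M : Type w} [L.Structure M]

section Definability

variable {α ι : Type*} {A B : Set M}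

theorem definable_fiber {R : Set (α ⊕ ι → M)} (hR : A.Definable L R) (hAB : A ⊆ B) {d : ι → M}
    (hd : ∀ i, d i ∈ B) : B.Definable L {x : α → M | Sum.elim x d ∈ R} := by
  obtain ⟨φ, rfl⟩ := Set.definable_iff_exists_formula_sum.1 hR
  refine Set.definable_iff_exists_formula_sum.2 ⟨φ.relabel
    (Sum.elim (fun a : A => Sum.inl ⟨a, hAB a.2⟩)
      (Sum.elim Sum.inr fun i => Sum.inl ⟨d i, hd i⟩)), ?_⟩
  ext x
  simp only [Set.mem_ofPred_eq, Formula.realize_relabel]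
  refine iff_of_eq (congrArg _ ?_)
  funext i
  rcases i with a | a | i <;> rfl

theorem exists_definable_fiber {d : ι → M} {s : Set (α → M)}
    (hs : (A ∪ Set.range d).Definable L s) :
    ∃ R : Set (α ⊕ ι → M), A.Definable L R ∧ s = {x : α → M | Sum.elim x d ∈ R} := by
  obtain ⟨φ, rfl⟩ := Set.definable_iff_exists_formula_sum.1 hs
  have hg : ∀ a : ↥(A ∪ Set.range d), ∃ t : A ⊕ (α ⊕ ι), ∀ x : α → M,
      Sum.elim (fun a : A => (a : M)) (Sum.elim x d) t = a := by
    rintro ⟨a, ha | ⟨i, rfl⟩⟩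
    · exact ⟨Sum.inl ⟨a, ha⟩, fun _ => rfl⟩
    · exact ⟨Sum.inr (Sum.inr i), fun _ => rfl⟩
  choose g hg using hg
  refine ⟨_, Set.definable_iff_exists_formula_sum.2
    ⟨φ.relabel (Sum.elim g fun a => Sum.inr (Sum.inl a)), rfl⟩, ?_⟩
  ext x
  simp only [Set.mem_ofPred_eq, Formula.realize_relabel]
  refine iff_of_eq (congrArg _ ?_)
  funext i
  rcases i with a | a
  · exact (hg a x).symm
  · rfl

theorem definable_setOf_realize (φ : L.Formula (α ⊕ ι)) {d : ι → M} (hd : ∀ i, d i ∈ A) :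
    A.Definable L {x : α → M | φ.Realize (Sum.elim x d)} :=
  definable_fiber (Set.empty_definable_iff.2 ⟨φ, rfl⟩ : (∅ : Set M).Definable L
    {z : α ⊕ ι → M | φ.Realize z}) (Set.empty_subset A) hd

theorem exists_formula_fin_params (M : Type w) [L.Structure M] (φ : L.Formula (α ⊕ ι)) :
    ∃ (k : ℕ) (ψ : L.Formula (α ⊕ Fin k)) (g : Fin k → ι), ∀ (x : α → M) (z : ι → M),
      φ.Realize (Sum.elim x z) ↔ ψ.Realize (Sum.elim x (z ∘ g)) := by
  classical
  let e := φ.freeVarFinset.toRight.equivFin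
  refine ⟨_, φ.restrictFreeVar (fun a => match a with
    | ⟨Sum.inl a, _⟩ => Sum.inl a
    | ⟨Sum.inr b, hb⟩ => Sum.inr (e ⟨b, by simpa using hb⟩)), fun i => e.symm i, fun x z => ?_⟩
  refine (BoundedFormula.realize_restrictFreeVar (Sum.elim x z) ?_).symm
  rintro ⟨a | b, h⟩ <;> simp

theorem definable_iff_exists_params {s : Set (α → M)} : A.Definable L s ↔
    ∃ (k : ℕ) (ψ : L.Formula (α ⊕ Fin k)) (d : Fin k → M),
      (∀ j, d j ∈ A) ∧ s = {x | ψ.Realize (Sum.elim x d)} := by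
  constructor
  · intro h
    obtain ⟨φ, rfl⟩ := Set.definable_iff_exists_formula_sum.1 h
    obtain ⟨k, ψ, g, hg⟩ := exists_formula_fin_params M (φ.relabel Sum.swap)
    refine ⟨k, ψ, fun i => g i, fun j => (g j).2, ?_⟩
    ext x
    have hx := hg x fun a : A => (a : M)
    simp only [Formula.realize_relabel] at hx
    refine Iff.trans (iff_of_eq (congrArg φ.Realize ?_)) hx
    funext i
    rcases i with a | a <;> rfl
  · rintro ⟨k, ψ, d, hd, rfl⟩
    exact definable_setOf_realize ψ hd

theorem exists_definable_of_directed_iUnion [Nonempty ι] {N : ι → Set M}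
    (hN : Directed (· ⊆ ·) N) {s : Set (α → M)} (hs : (⋃ i, N i).Definable L s) :
    ∃ i, (N i).Definable L s := by
  obtain ⟨A₀, hA₀, hs⟩ := Set.definable_iff_finitely_definable.1 hs
  obtain ⟨i, hi⟩ := hN.exists_mem_subset_of_finset_subset_biUnion hA₀
  exact ⟨i, hs.mono hi⟩

end Definability

section SameType

variable {ι κ : Type*} {A B : Set M} {a b : ι → M}

/-- `a ≡_A b` for tuples of arbitrary length: `a` and `b` lie in the same `A`-definable sets. It
extends `SameTypeOver`, which only covers tuples indexed by `Fin k`. -/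
def SameType (L : FirstOrder.Language.{u, v}) {M : Type w} [L.Structure M] (A : Set M)
    {ι : Type*} (a b : ι → M) : Prop :=
  ∀ s : Set (ι → M), A.Definable L s → (a ∈ s ↔ b ∈ s)

theorem SameType.refl (a : ι → M) : SameType L A a a := fun _ _ => Iff.rfl

theorem SameType.mono (h : SameType L B a b) (hAB : A ⊆ B) : SameType L A a b :=
  fun s hs => h s (hs.mono hAB)

theorem SameType.comp (h : SameType L A a b) (g : κ → ι) : SameType L A (a ∘ g) (b ∘ g) :=
  fun _ hs => h _ (hs.preimage_comp g)

theorem SameType.sumElim_params (h : SameType L A a b) {d : κ → M} (hd : ∀ i, d i ∈ A) :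
    SameType L A (Sum.elim a d) (Sum.elim b d) :=
  fun _ hs => h _ (definable_fiber hs subset_rfl hd)

theorem sameTypeOver_iff_sameType {k : ℕ} {a b : Fin k → M} :
    SameTypeOver (L := L) A a b ↔ SameType L A a b := by
  refine ⟨fun h s hs => ?_, fun h _ χ _ hd => h _ (definable_setOf_realize χ hd)⟩
  obtain ⟨l, χ, d, hd, rfl⟩ := definable_iff_exists_params.1 hs
  exact h l χ d hd

/-- `π` is an `A`-elementary map on `B`: the set `B`, enumerated by itself, and its image under `π`
have the same type over `A`. The values of `π` outside `B` are irrelevant. -/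
def IsElementaryOn (L : FirstOrder.Language.{u, v}) {M : Type w} [L.Structure M] (A B : Set M)
    (π : M → M) : Prop :=
  SameType L A ((↑) : B → M) (π ∘ (↑))

theorem IsElementaryOn.sameType {π : M → M} (hπ : IsElementaryOn L A B π)
    (ha : ∀ i, a i ∈ B) : SameType L A a (π ∘ a) :=
  hπ.comp fun i => (⟨a i, ha i⟩ : B)

end SameType

section Ultrafilters

theorem exists_ultrafilter_of_inter_mem {X : Type*} {S : Set (Set X)} (hS : S.Nonempty)
    (hinter : ∀ s ∈ S, ∀ t ∈ S, s ∩ t ∈ S) (hne : ∀ s ∈ S, s.Nonempty) :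
    ∃ V : Ultrafilter X, ∀ s ∈ S, s ∈ V := by
  let b : FilterBasis X :=
    { sets := S
      nonempty := hS
      inter_sets := fun hs ht => ⟨_, hinter _ hs _ ht, subset_rfl⟩ }
  have : b.filter.NeBot := b.hasBasis.neBot_iff.2 fun hs => hne _ hs
  exact ⟨Ultrafilter.of b.filter, fun s hs => Ultrafilter.of_le _ (b.mem_filter_of_mem hs)⟩

variable {α ι κ : Type*} {A B C : Set M} {W : Ultrafilter (α → M)} {e e' : α → M}

/-- `e ⊨ W ↾ A`, where an ultrafilter `W` on tuples stands for the global type consisting of the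
formulas with parameters in `M` whose solution set belongs to `W`. -/
def Realizes (L : FirstOrder.Language.{u, v}) {M : Type w} [L.Structure M] {α : Type*}
    (W : Ultrafilter (α → M)) (A : Set M) (e : α → M) : Prop :=
  ∀ s, A.Definable L s → (e ∈ s ↔ s ∈ W)

theorem realizes_of_imp (h : ∀ s, A.Definable L s → s ∈ W → e ∈ s) : Realizes L W A e :=
  fun s hs => ⟨fun he => by_contra fun hn =>
    h _ hs.compl (Ultrafilter.compl_mem_iff_notMem.2 hn) he, h s hs⟩

theorem Realizes.mono (h : Realizes L W B e) (hAB : A ⊆ B) : Realizes L W A e :=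
  fun s hs => h s (hs.mono hAB)

theorem Realizes.sameType (h : Realizes L W A e) (h' : Realizes L W A e') : SameType L A e e' :=
  fun s hs => (h s hs).trans (h' s hs).symm

/-- Invariance over `A` of the global type given by the ultrafilter `W`. -/
def IsInvariantUltrafilter (L : FirstOrder.Language.{u, v}) {M : Type w} [L.Structure M]
    {α : Type*} (A : Set M) (W : Ultrafilter (α → M)) : Prop :=
  ∀ (k : ℕ) (ψ : L.Formula (α ⊕ Fin k)) (d d' : Fin k → M), SameType L A d d' →
    ({x | ψ.Realize (Sum.elim x d)} ∈ W ↔ {x | ψ.Realize (Sum.elim x d')} ∈ W)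

theorem IsInvariantUltrafilter.mem_iff (hW : IsInvariantUltrafilter L A W)
    {R : Set (α ⊕ ι → M)} (hR : A.Definable L R) {c c' : ι → M} (hc : SameType L A c c') :
    {x | Sum.elim x c ∈ R} ∈ W ↔ {x | Sum.elim x c' ∈ R} ∈ W := by
  obtain ⟨k, ψ, d, hd, rfl⟩ := definable_iff_exists_params.1 hR
  obtain ⟨l, χ, g, hg⟩ := exists_formula_fin_params M (ψ.relabel (Equiv.sumAssoc α ι (Fin k)))
  have hχ : ∀ (x : α → M) (c : ι → M),
      ψ.Realize (Sum.elim (Sum.elim x c) d) ↔ χ.Realize (Sum.elim x (Sum.elim c d ∘ g)) := by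
    intro x c
    rw [← hg, Formula.realize_relabel]
    refine iff_of_eq (congrArg ψ.Realize ?_)
    funext i
    rcases i with (i | i) | i <;> rfl
  simp only [Set.mem_ofPred_eq, hχ]
  exact hW l χ _ _ ((hc.sumElim_params hd).comp g)

theorem Realizes.sameType_sumElim (hW : IsInvariantUltrafilter L A W) {c c' : ι → M}
    (hc : SameType L A c c') (h : Realizes L W (A ∪ Set.range c) e)
    (h' : Realizes L W (A ∪ Set.range c') e') : SameType L A (Sum.elim e c) (Sum.elim e' c') := by
  intro R hR
  have hfib : ∀ c : ι → M, (A ∪ Set.range c).Definable L {x : α → M | Sum.elim x c ∈ R} :=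
    fun c => definable_fiber hR Set.subset_union_left fun i => Or.inr ⟨i, rfl⟩
  exact (h _ (hfib c)).trans ((hW.mem_iff hR hc).trans (h' _ (hfib c')).symm)

theorem Realizes.of_sameType (hW : IsInvariantUltrafilter L A W) {c c' : ι → M}
    (hec : SameType L A (Sum.elim e c) (Sum.elim e' c')) (h : Realizes L W (A ∪ Set.range c) e) :
    Realizes L W (A ∪ Set.range c') e' := by
  intro s hs
  obtain ⟨R, hR, rfl⟩ := exists_definable_fiber hs
  have hfib : (A ∪ Set.range c).Definable L {x : α → M | Sum.elim x c ∈ R} :=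
    definable_fiber hR Set.subset_union_left fun i => Or.inr ⟨i, rfl⟩
  exact (hec R hR).symm.trans ((h _ hfib).trans (hW.mem_iff hR (hec.comp Sum.inr)))

theorem Realizes.map (hW : IsInvariantUltrafilter L A W) {π : M → M}
    (hπ : IsElementaryOn L A B π) (he : ∀ j, e j ∈ B) (hC : C ⊆ B)
    (h : Realizes L W (A ∪ C) e) : Realizes L W (A ∪ π '' C) (π ∘ e) := by
  have hrange : Set.range (π ∘ ((↑) : C → M)) = π '' C := by
    rw [Set.range_comp, Subtype.range_coe]
  rw [← hrange]
  rw [← Subtype.range_coe (s := C)] at h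
  refine h.of_sameType hW ?_
  rw [← Sum.comp_elim]
  exact hπ.sameType fun i => i.casesOn he fun c => hC c.2

end Ultrafilters

section GlobalTypes

variable {A : Set M}

theorem exists_ultrafilter_mem_iff {α : Type*} [Finite α]
    (p : (L.completeTheory M).CompleteType α) :
    ∃ W : Ultrafilter (α → M), ∀ θ : L.Formula α,
      Formula.equivSentence θ ∈ p ↔ {x | θ.Realize x} ∈ W := by
  obtain ⟨𝓜, v, rfl⟩ := Theory.exists_modelType_is_realized_in _ p
  have hne : ∀ θ : L.Formula α, θ.Realize v → ∃ x : α → M, θ.Realize x := by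
    intro θ hθ
    let χ : L.Sentence := (θ.relabel Sum.inr : L.Formula (Empty ⊕ α)).iExs
    have hχ : 𝓜 ⊨ χ ↔ M ⊨ χ := realize_iff_of_model_completeTheory M 𝓜 χ
    simp only [χ, Sentence.Realize, Formula.realize_iExs, Formula.realize_relabel,
      Sum.elim_comp_inr] at hχ
    exact hχ.1 ⟨v, hθ⟩
  obtain ⟨W, hW⟩ := exists_ultrafilter_of_inter_mem
    (S := {t : Set (α → M) | ∃ θ : L.Formula α, θ.Realize v ∧ t = {x | θ.Realize x}})
    ⟨_, ⊤, Formula.realize_top.2 trivial, rfl⟩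
    (by
      rintro _ ⟨θ, hθ, rfl⟩ _ ⟨θ', hθ', rfl⟩
      exact ⟨θ ⊓ θ', Formula.realize_inf.2 ⟨hθ, hθ'⟩, by ext; exact Formula.realize_inf.symm⟩)
    (by
      rintro _ ⟨θ, hθ, rfl⟩
      exact hne θ hθ)
  refine ⟨W, fun θ => Theory.CompleteType.formula_mem_typeOf.trans
    ⟨fun h => hW _ ⟨θ, h, rfl⟩, fun h => ?_⟩⟩
  by_contra hn
  exact Ultrafilter.compl_mem_iff_notMem.1 (hW _ ⟨θ.not, Formula.realize_not.2 hn, rfl⟩) h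

variable {α : Type} {W : Ultrafilter (α → M)} {p : GlobalType L M α} {e : α → M}

/-- `p` is the global type given by the ultrafilter `W` on tuples. -/
def Represents (W : Ultrafilter (α → M)) (p : GlobalType L M α) : Prop :=
  ∀ (k : ℕ) (ψ : L.Formula (α ⊕ Fin k)) (d : Fin k → M),
    p.Holds ψ d ↔ {x | ψ.Realize (Sum.elim x d)} ∈ W

theorem exists_represents [Finite α] (p : GlobalType L M α) : ∃ W, Represents W p := by
  obtain ⟨W, hW⟩ := exists_ultrafilter_mem_iff p
  refine ⟨W, fun k ψ d => (hW (ψ.plug d)).trans ?_⟩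
  simp only [Formula.realize_plug]

theorem Represents.isInvariantUltrafilter_iff (hW : Represents W p) :
    IsInvariantUltrafilter L A W ↔ p.IsInvariant A := by
  simp only [IsInvariantUltrafilter, GlobalType.IsInvariant, sameTypeOver_iff_sameType, hW _ _ _]

theorem Represents.realizes_iff (hW : Represents W p) :
    Realizes L W A e ↔ p.RealizedOver A e := by
  refine ⟨fun h k ψ d hd => (hW k ψ d).trans (h _ (definable_setOf_realize ψ hd)).symm,
    fun h s hs => ?_⟩
  obtain ⟨k, ψ, d, hd, rfl⟩ := definable_iff_exists_params.1 hs
  exact (h k ψ d hd).symm.trans (hW k ψ d)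

end GlobalTypes

section Saturation

variable {A : Set M} {n : ℕ} {μ μ' : Cardinal.{w}}

theorem isSaturated_mono [Nonempty M] (h : L.IsSaturated μ' M) (hμ : μ ≤ μ') : L.IsSaturated μ M :=
  fun A hA => h A (hA.trans_le hμ)

theorem exists_realize_of_isSaturated [Nonempty M] (h : L.IsSaturated μ M) (hA : #A < μ)
    {N : Type w} [L[[A]].Structure N] [Nonempty N] [N ⊨ L[[A]].completeTheory M] (v : Fin n → N) :
    ∃ e : Fin n → M, ∀ θ : L[[A]].Formula (Fin n), θ.Realize v → θ.Realize e := by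
  obtain ⟨e, he⟩ := h A hA n (Theory.typeOf (L[[A]].completeTheory M) v)
  refine ⟨e, fun θ hθ => ?_⟩
  rwa [← Theory.CompleteType.formula_mem_typeOf (T := L[[A]].completeTheory M), he,
    Theory.CompleteType.formula_mem_typeOf]

theorem exists_realizes_of_isSaturated [Nonempty M] (h : L.IsSaturated μ M) (hA : #A < μ)
    (V : Ultrafilter (Fin n → M)) : ∃ e, Realizes L V A e := by
  let 𝓤 : Type w := (V : Filter (Fin n → M)).Product fun _ => M
  let _ : L[[A]].Structure 𝓤 := Ultraproduct.structure
  have : Nonempty 𝓤 := Ultraproduct.Product.instNonempty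
  have : 𝓤 ⊨ L[[A]].completeTheory M := ⟨fun θ hθ =>
    (Ultraproduct.sentence_realize (u := V) (M := fun _ => M) θ).2
      (Filter.Eventually.of_forall fun _ => hθ)⟩
  let v : Fin n → 𝓤 := fun i =>
    ((fun c => c i : (Fin n → M) → M) : (V : Filter (Fin n → M)).Product fun _ => M)
  obtain ⟨e, he⟩ := exists_realize_of_isSaturated h hA v
  refine ⟨e, realizes_of_imp ?_⟩
  rintro _ ⟨θ, rfl⟩ hθ
  exact he θ
    ((Ultraproduct.realize_formula_cast (u := V) (M := fun _ => M) θ fun i c => c i).2 hθ)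

end Saturation

section FiniteSatisfiability

theorem sumElim_comp_swap {X Y Z : Type*} (f : X → Z) (g : Y → Z) :
    Sum.elim f g ∘ Sum.swap = Sum.elim g f := by
  ext (i | i) <;> rfl

variable {α ι κ : Type*} {A : Set M} {V : Ultrafilter (α → M)} {P : Set (α → M)}
  {D : Set (ι → M)} {a : ι → M} {e : α → M}

/-- `tp(a/A)` is finitely satisfiable in the set of tuples `D`. -/
def FinitelySatisfiableIn (L : FirstOrder.Language.{u, v}) {M : Type w} [L.Structure M]
    {ι : Type*} (A : Set M) (D : Set (ι → M)) (a : ι → M) : Prop :=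
  ∀ s, A.Definable L s → a ∈ s → (D ∩ s).Nonempty

theorem FinitelySatisfiableIn.exists_ultrafilter (h : FinitelySatisfiableIn L A D a) :
    ∃ V : Ultrafilter (ι → M), D ∈ V ∧ Realizes L V A a := by
  obtain ⟨V, hV⟩ := exists_ultrafilter_of_inter_mem
    (S := {t | ∃ s : Set (ι → M), A.Definable L s ∧ a ∈ s ∧ t = D ∩ s})
    ⟨_, Set.univ, Set.definable_univ, trivial, rfl⟩
    (by
      rintro _ ⟨s, hs, has, rfl⟩ _ ⟨t, ht, hat, rfl⟩
      exact ⟨s ∩ t, hs.inter ht, ⟨has, hat⟩, (Set.inter_inter_distrib_left D s t).symm⟩)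
    (by
      rintro _ ⟨s, hs, has, rfl⟩
      exact h s hs has)
  have hmem : ∀ s, A.Definable L s → a ∈ s → D ∩ s ∈ V := fun s hs has => hV _ ⟨s, hs, has, rfl⟩
  refine ⟨V, Filter.mem_of_superset (hmem _ Set.definable_univ trivial) Set.inter_subset_left,
    fun s hs => ⟨fun has => Filter.mem_of_superset (hmem s hs has) Set.inter_subset_right, ?_⟩⟩
  contrapose
  exact fun has => Ultrafilter.compl_mem_iff_notMem.1
    (Filter.mem_of_superset (hmem _ hs.compl has) Set.inter_subset_right)

theorem isInvariantUltrafilter_of_mem (hP : P ∈ V) (hPA : ∀ c ∈ P, ∀ j, c j ∈ A) :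
    IsInvariantUltrafilter L A V := by
  intro k ψ d d' hd
  refine Filter.congr_sets (Filter.mem_of_superset hP fun c hc => ?_)
  have hψ : A.Definable L {z : α ⊕ Fin k → M | ψ.Realize z} :=
    (Set.empty_definable_iff.2 ⟨ψ, rfl⟩ : (∅ : Set M).Definable L _).mono (Set.empty_subset A)
  have hcd := (hd.sumElim_params (hPA c hc)).comp Sum.swap
  rw [sumElim_comp_swap, sumElim_comp_swap] at hcd
  exact hcd _ hψ

theorem FinitelySatisfiableIn.sumElim (ha : FinitelySatisfiableIn L A D a)
    (he : Realizes L V (A ∪ Set.range a) e) (hP : P ∈ V) (hPA : ∀ c ∈ P, ∀ j, c j ∈ A) :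
    FinitelySatisfiableIn L A {z | z ∘ Sum.inl ∈ P ∧ z ∘ Sum.inr ∈ D} (Sum.elim e a) := by
  intro R hR heR
  have hfib : (A ∪ Set.range a).Definable L {x | Sum.elim x a ∈ R} :=
    definable_fiber hR Set.subset_union_left fun i => Or.inr ⟨i, rfl⟩
  obtain ⟨c, hcR, hcP⟩ := V.nonempty_of_mem (Filter.inter_mem ((he _ hfib).1 heR) hP)
  have hfib' : A.Definable L {y | Sum.elim y c ∈ (· ∘ Sum.swap) ⁻¹' R} :=
    definable_fiber (hR.preimage_comp _) subset_rfl (hPA c hcP)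
  simp only [Set.mem_preimage, sumElim_comp_swap] at hfib'
  obtain ⟨y, hyD, hyR⟩ := ha _ hfib' hcR
  exact ⟨Sum.elim c y, ⟨hcP, hyD⟩, hyR⟩

theorem FinitelySatisfiableIn.comp {D' : Set (κ → M)} (h : FinitelySatisfiableIn L A D a)
    (g : κ → ι) (hg : ∀ z ∈ D, z ∘ g ∈ D') : FinitelySatisfiableIn L A D' (a ∘ g) := by
  intro s hs has
  obtain ⟨z, hzD, hzs⟩ := h _ (hs.preimage_comp g) has
  exact ⟨z ∘ g, hg z hzD, hzs⟩

end FiniteSatisfiability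

section MorleyFamilies

variable {α ι κ : Type*} {A B : Set M} {W : Ultrafilter (α → M)} {r : ι → ι → Prop}
  {e e' : ι → α → M} {X Y : Set ι}

/-- All coordinates of the members `e i`, `i ∈ X`, of a family of tuples. -/
def coords (e : ι → α → M) (X : Set ι) : Set M := ⋃ i ∈ X, Set.range (e i)

/-- The members `e i`, `i ∈ X`, of a family of tuples concatenated into a single tuple. -/
def tupleOn (e : ι → α → M) (X : Set ι) : X × α → M := fun p => e p.1 p.2

theorem range_tupleOn (e : ι → α → M) (X : Set ι) : Set.range (tupleOn e X) = coords e X := by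
  ext y
  simp [tupleOn, coords]

theorem range_subset_coords {i : ι} (hi : i ∈ X) : Set.range (e i) ⊆ coords e X :=
  Set.subset_biUnion_of_mem (u := fun i => Set.range (e i)) hi

theorem mem_coords {i : ι} (hi : i ∈ X) (j : α) : e i j ∈ coords e X :=
  range_subset_coords hi ⟨j, rfl⟩

theorem coords_mono (h : X ⊆ Y) : coords e X ⊆ coords e Y := Set.biUnion_subset_biUnion_left h

theorem finite_coords [Finite α] (hX : X.Finite) : (coords e X).Finite :=
  hX.biUnion fun i _ => Set.finite_range (e i)

/-- `(e i)_{i ∈ X}` is a Morley family over `A` generated by `W`: each `e i` realizes the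
restriction of `W` to `A` together with the members of the family that precede it. Here `r j i`
says that `j` precedes `i`. -/
def IsMorleyOn (L : FirstOrder.Language.{u, v}) {M : Type w} [L.Structure M] {α ι : Type*}
    (W : Ultrafilter (α → M)) (A : Set M) (r : ι → ι → Prop) (e : ι → α → M) (X : Set ι) : Prop :=
  ∀ i ∈ X, Realizes L W (A ∪ coords e {j ∈ X | r j i}) (e i)

theorem isMorleyOn_singleton [Std.Irrefl r] {i : ι} :
    IsMorleyOn L W A r e {i} ↔ Realizes L W A (e i) := by
  have hempty : {j ∈ ({i} : Set ι) | r j i} = ∅ :=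
    Set.eq_empty_of_forall_notMem fun j hj => irrefl_of r i (hj.1 ▸ hj.2)
  exact forall_eq.trans (by rw [hempty, coords, Set.biUnion_empty, Set.union_empty])

theorem IsMorleyOn.mono (h : IsMorleyOn L W B r e Y) (hAB : A ⊆ B) (hXY : X ⊆ Y) :
    IsMorleyOn L W A r e X := fun i hi => (h i (hXY hi)).mono <|
  Set.union_subset_union hAB <| coords_mono fun _ hj => ⟨hXY hj.1, hj.2⟩

theorem IsMorleyOn.comp {r' : κ → κ → Prop} {Z : Set κ} (h : IsMorleyOn L W A r e X) {g : κ → ι}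
    (hg : Set.MapsTo g Z X) (hr : ∀ i ∈ Z, ∀ j ∈ Z, r' j i → r (g j) (g i)) :
    IsMorleyOn L W A r' (e ∘ g) Z := by
  refine fun i hi => (h (g i) (hg hi)).mono (Set.union_subset_union_right A ?_)
  exact Set.iUnion₂_subset fun j hj =>
    range_subset_coords (X := {j ∈ X | r j (g i)}) ⟨hg hj.1, hr i hi j hj.1 hj.2⟩

theorem IsMorleyOn.map (hW : IsInvariantUltrafilter L A W) {π : M → M}
    (hπ : IsElementaryOn L A B π) (hB : coords e X ⊆ B) (h : IsMorleyOn L W A r e X) :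
    IsMorleyOn L W A r (fun i => π ∘ e i) X := by
  intro i hi
  have himage : π '' coords e {j ∈ X | r j i} = coords (fun i => π ∘ e i) {j ∈ X | r j i} := by
    simp only [coords, Set.image_iUnion, Set.range_comp]
  rw [← himage]
  exact (h i hi).map hW hπ (fun j => hB (mem_coords hi j))
    ((coords_mono (Set.sep_subset X _)).trans hB)

theorem IsMorleyOn.of_sameType (hW : IsInvariantUltrafilter L A W) {b b' : κ → M}
    (hbe : SameType L A (Sum.elim b (tupleOn e X)) (Sum.elim b' (tupleOn e' X)))
    (h : IsMorleyOn L W (A ∪ Set.range b) r e X) : IsMorleyOn L W (A ∪ Set.range b') r e' X := by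
  intro i hi
  have hrange : ∀ (b : κ → M) (e : ι → α → M), A ∪ Set.range b ∪ coords e {j ∈ X | r j i} =
      A ∪ Set.range (Sum.elim b (tupleOn e {j ∈ X | r j i})) := fun b e => by
    rw [Set.Sum.elim_range, range_tupleOn, Set.union_assoc]
  have hi' := h i hi
  rw [hrange] at hi' ⊢
  let g : α ⊕ (κ ⊕ ({j ∈ X | r j i} × α)) → κ ⊕ (X × α) := Sum.elim (fun j => Sum.inr (⟨i, hi⟩, j))
    (Sum.map id fun p => (⟨p.1, p.1.2.1⟩, p.2))
  have hg : ∀ (b : κ → M) (e : ι → α → M), Sum.elim b (tupleOn e X) ∘ g =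
      Sum.elim (e i) (Sum.elim b (tupleOn e {j ∈ X | r j i})) := by
    intro b e
    funext t
    rcases t with t | t | t <;> rfl
  refine hi'.of_sameType hW ?_
  rw [← hg, ← hg]
  exact hbe.comp g

theorem finite_induction_on_max (r : ι → ι → Prop) [IsStrictTotalOrder ι r]
    {Q : ∀ X : Set ι, X.Finite → Prop} (X : Set ι) (hX : X.Finite) (empty : Q ∅ Set.finite_empty)
    (insert_max : ∀ (i : ι) (S : Set ι) (hS : S.Finite), (∀ j ∈ S, r j i) → Q S hS →
      Q (insert i S) (hS.insert i)) : Q X hX := by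
  classical
  let := linearOrderOfSTO r
  obtain ⟨X, rfl⟩ := hX.exists_finset_coe
  induction X using Finset.induction_on_max with
  | empty => simpa using empty
  | insert i S hS ih => simpa using insert_max i S S.finite_toSet hS (ih _)

theorem exists_tupleOn_insert (i : ι) (S : Set ι) :
    ∃ g : ↥(insert i S) × α → α ⊕ (S × α),
      ∀ e : ι → α → M, Sum.elim (e i) (tupleOn e S) ∘ g = tupleOn e (insert i S) := by
  classical
  refine ⟨fun p => if h : (p.1 : ι) = i then Sum.inl p.2 else
    Sum.inr (⟨p.1, p.1.2.resolve_left h⟩, p.2), fun e => ?_⟩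
  funext p
  by_cases h : (p.1 : ι) = i <;> simp [tupleOn, h]

theorem IsMorleyOn.realizes_of_insert {i : ι} (h : IsMorleyOn L W A r e (insert i X))
    (hi : ∀ j ∈ X, r j i) : Realizes L W (A ∪ Set.range (tupleOn e X)) (e i) := by
  rw [range_tupleOn]
  exact (h i (Set.mem_insert i X)).mono (Set.union_subset_union_right A
    (coords_mono fun _ hj => ⟨Set.mem_insert_of_mem i hj, hi _ hj⟩))

theorem IsMorleyOn.sameType [IsStrictTotalOrder ι r] (hW : IsInvariantUltrafilter L A W)
    (hX : X.Finite) (h : IsMorleyOn L W A r e X) (h' : IsMorleyOn L W A r e' X) :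
    SameType L A (tupleOn e X) (tupleOn e' X) := by
  induction X, hX using finite_induction_on_max r with
  | empty =>
    rw [Subsingleton.elim (tupleOn e ∅) (tupleOn e' ∅)]
    exact SameType.refl _
  | insert_max i S _ hi ih =>
    obtain ⟨g, hg⟩ := exists_tupleOn_insert (M := M) (α := α) i S
    rw [← hg, ← hg]
    exact (Realizes.sameType_sumElim hW
      (ih (h.mono subset_rfl (Set.subset_insert i S)) (h'.mono subset_rfl (Set.subset_insert i S)))
      (h.realizes_of_insert hi) (h'.realizes_of_insert hi)).comp g

theorem exists_rank (r : ι → ι → Prop) [IsStrictOrder ι r] (hX : X.Finite) :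
    ∃ g : ι → ℕ, (∀ i ∈ X, g i < X.ncard) ∧ ∀ i ∈ X, ∀ j ∈ X, r i j → g i < g j := by
  refine ⟨fun i => {j ∈ X | r j i}.ncard, fun i hi => ?_, fun i hi j _ hij => ?_⟩
  · exact Set.ncard_lt_ncard ⟨Set.sep_subset X _, fun h => irrefl_of r i (h hi).2⟩ hX
  · exact Set.ncard_lt_ncard ⟨fun k hk => ⟨hk.1, trans_of r hk.2 hij⟩,
      fun h => irrefl_of r i (h ⟨hi, hij⟩).2⟩ (hX.subset (Set.sep_subset X _))

theorem IsMorleyOn.exists_sameType_comp [IsStrictTotalOrder ι r]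
    (hW : IsInvariantUltrafilter L A W) (hX : X.Finite) (h : IsMorleyOn L W A r e X)
    {E : ℕ → α → M} (hE : IsMorleyOn L W B (· < ·) E (Set.Iio X.ncard)) (hAB : A ⊆ B) :
    ∃ g : ι → ℕ, Set.MapsTo g X (Set.Iio X.ncard) ∧ IsMorleyOn L W B r (E ∘ g) X ∧
      SameType L A (tupleOn (E ∘ g) X) (tupleOn e X) := by
  obtain ⟨g, hgX, hg⟩ := exists_rank r hX
  have hEg : IsMorleyOn L W B r (E ∘ g) X :=
    hE.comp hgX fun i hi j hj => hg j hj i hi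
  exact ⟨g, hgX, hEg, (hEg.mono hAB subset_rfl).sameType hW hX h⟩

theorem IsMorleyOn.finitelySatisfiableIn [IsStrictTotalOrder ι r] {P : Set (α → M)} (hP : P ∈ W)
    (hPA : ∀ c ∈ P, ∀ j, c j ∈ A) (hX : X.Finite) (h : IsMorleyOn L W A r e X) :
    FinitelySatisfiableIn L A ((tupleOn · X) '' {c | Set.MapsTo c X P}) (tupleOn e X) := by
  classical
  induction X, hX using finite_induction_on_max r with
  | empty => exact fun _ _ hes => ⟨_, ⟨e, Set.mapsTo_empty e P, rfl⟩, hes⟩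
  | insert_max i S _ hi ih =>
    obtain ⟨g, hg⟩ := exists_tupleOn_insert (M := M) (α := α) i S
    rw [← hg]
    refine ((ih (h.mono subset_rfl (Set.subset_insert i S))).sumElim
      (h.realizes_of_insert hi) hP hPA).comp g ?_
    rintro z ⟨hzP, c, hc, hcz⟩
    have hiS : ∀ j ∈ S, j ≠ i := fun j hj hji => irrefl_of r i (hji ▸ hi j hj)
    let c' := Function.update c i (z ∘ Sum.inl)
    have hc'S : ∀ j ∈ S, c' j = c j := fun j hj => Function.update_of_ne (hiS j hj) _ c
    have hc'i : c' i = z ∘ Sum.inl := Function.update_self i _ c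
    refine ⟨c', ?_, ?_⟩
    · rintro j (rfl | hj)
      · rwa [hc'i]
      · rw [hc'S j hj]
        exact hc hj
    · have hc'c : tupleOn c' S = z ∘ Sum.inr := by
        rw [← hcz]
        ext p
        exact congrFun (hc'S p.1 p.1.2) p.2
      simp only [← hg c', hc'i, hc'c, Sum.elim_comp_inl_inr]

theorem definable_setOf_apply_eq (i j : α) : A.Definable L {x : α → M | x i = x j} :=
  (Set.empty_definable_iff.2 ⟨(Term.var i).equal (Term.var j), by ext; simp⟩ :
    (∅ : Set M).Definable L _).mono (Set.empty_subset A)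

theorem Realizes.apply_ne {j : α} (hW : ∀ a, {x | x j ≠ a} ∈ W) {e : α → M}
    (h : Realizes L W A e) {a : M} (ha : a ∈ A) : e j ≠ a := by
  have hne : A.Definable L {z : α ⊕ Unit → M | z (Sum.inl j) = z (Sum.inr ())}ᶜ :=
    (definable_setOf_apply_eq _ _).compl
  have hdef : A.Definable L {x : α → M | x j ≠ a} :=
    definable_fiber hne subset_rfl fun _ => ha
  exact (h _ hdef).2 (hW a)

theorem IsMorleyOn.injOn_apply [IsStrictTotalOrder ι r] {j : α} (hW : ∀ a, {x | x j ≠ a} ∈ W)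
    (h : IsMorleyOn L W A r e X) : Set.InjOn (fun i => e i j) X := by
  have hne : ∀ i ∈ X, ∀ i' ∈ X, r i' i → e i j ≠ e i' j := fun i hi i' hi' hr =>
    (h i hi).apply_ne hW (Or.inr (mem_coords (X := {k ∈ X | r k i}) ⟨hi', hr⟩ j))
  intro i hi i' hi' heq
  by_contra hii'
  rcases trichotomous_of r i i' with hr | hr | hr
  · exact hne i' hi' i hi hr heq.symm
  · exact hii' hr
  · exact hne i hi i' hi' hr heq

end MorleyFamilies

section Reversibility

variable {α ι : Type*} {A B : Set M} {W : Ultrafilter (α → M)} {r : ι → ι → Prop} {s : ℕ}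

theorem mk_union_lt_of_finite {μ : Cardinal.{w}} (hμ : ℵ₀ ≤ μ) (hA : #A < μ) (hB : B.Finite) :
    #↥(A ∪ B) < μ :=
  (mk_union_le A B).trans_lt (add_lt_of_lt hμ hA ((lt_aleph0_iff_set_finite.2 hB).trans_le hμ))

/-- The part of bi-invariance of `W^{⊗s}` over `A` that concerns finite tuples `b`: some Morley
sequence `E` of length `s` over `A b` is such that `tp(b/A E)` extends to a global `A`-invariant
type. -/
def IsReversible (L : FirstOrder.Language.{u, v}) {M : Type w} [L.Structure M] {α : Type*}
    (A : Set M) (W : Ultrafilter (α → M)) (s : ℕ) : Prop :=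
  ∀ (k : ℕ) (b : Fin k → M), ∃ E : ℕ → α → M,
    IsMorleyOn L W (A ∪ Set.range b) (· < ·) E (Set.Iio s) ∧
      ∃ q : Ultrafilter (Fin k → M), IsInvariantUltrafilter L A q ∧
        Realizes L q (A ∪ coords E (Set.Iio s)) b

/- The conjugate of `B` is chosen so that `tp(π B/A B)` is a restriction of an `A`-invariant type.
Over `A`, a Morley family in `B` of size at most `s` is conjugate to a part of the sequence `E`
provided by reversibility, which is Morley over `A B`; by invariance, so is the family over
`A π(B)`. -/
theorem exists_isElementaryOn_isMorleyOn [Nonempty M] [Finite α] [IsStrictTotalOrder ι r]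
    {μ : Cardinal.{w}} (hμ : ℵ₀ ≤ μ) (hM : L.IsSaturated μ M) (hA : #A < μ)
    (hW : IsInvariantUltrafilter L A W) (hWs : IsReversible L A W s) (hB : B.Finite) :
    ∃ π : M → M, IsElementaryOn L A B π ∧ ∀ (e : ι → α → M) (X : Set ι), X.Finite → X.ncard ≤ s →
      coords e X ⊆ B → IsMorleyOn L W A r e X → IsMorleyOn L W (A ∪ π '' B) r e X := by
  obtain ⟨k, b, hb, rfl⟩ := hB.fin_param
  obtain ⟨E, hE, q, hq, hqb⟩ := hWs k b
  have hsmall : #↥(A ∪ (coords E (Set.Iio s) ∪ Set.range b)) < μ :=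
    mk_union_lt_of_finite hμ hA ((finite_coords (Set.finite_Iio s)).union (Set.finite_range b))
  obtain ⟨b', hb'⟩ := exists_realizes_of_isSaturated hM hsmall q
  have hbb' : SameType L A b b' := (hqb.mono Set.subset_union_left).sameType
    (hb'.mono Set.subset_union_left)
  let π : M → M := Function.extend b b' id
  have hπb : π ∘ b = b' := funext fun i => hb.extend_apply b' id i
  refine ⟨π, ?_, fun e X hX hXs heX he => ?_⟩
  · have hval : ((↑) : Set.range b → M) = b ∘ fun y => y.2.choose :=
      funext fun y => y.2.choose_spec.symm
    rw [IsElementaryOn, hval, ← Function.comp_assoc, hπb]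
    exact hbb'.comp _
  · obtain ⟨g, hgX, hEg, hsame⟩ := he.exists_sameType_comp hW hX
      (hE.mono subset_rfl (Set.Iio_subset_Iio hXs)) Set.subset_union_left
    rw [← Set.range_comp, hπb]
    refine hEg.of_sameType hW (Realizes.sameType_sumElim hq hsame (hqb.mono ?_) (hb'.mono ?_))
    · rw [range_tupleOn]
      refine Set.union_subset_union_right A (Set.iUnion₂_subset fun i hi => ?_)
      exact range_subset_coords (X := Set.Iio s) ((hgX hi).trans_le hXs)
    · rw [range_tupleOn]
      exact Set.union_subset_union_right A (heX.trans Set.subset_union_right)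

end Reversibility

section BinaryTrees

/-- A set of nodes of the binary tree is left-bounded by `s` if, at every node `σ` with elements of
the set above `σ⌢1`, at most `s` elements of the set lie above `σ⌢0`. Right-combs are left-bounded
by `1`, which is what separates CTP from ATP here. -/
def IsLeftBounded (s : ℕ) (X : Set (List Bool)) : Prop :=
  ∀ σ τ, σ ++ true :: τ ∈ X → {τ' | σ ++ false :: τ' ∈ X}.encard ≤ s

theorem IsLeftBounded.mono {s : ℕ} {X Y : Set (List Bool)} (hY : IsLeftBounded s Y) (hXY : X ⊆ Y) :
    IsLeftBounded s X := fun σ τ hτ =>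
  (hY σ τ (hXY hτ)).trans' (Set.encard_le_encard fun _ hτ' => hXY hτ')

theorem isLeftBounded_of_card_le {s : ℕ} {F : Finset (List Bool)} (hF : F.card ≤ s) :
    IsLeftBounded s (F : Set (List Bool)) := by
  intro σ _ _
  have hinj : Function.Injective fun τ => σ ++ false :: τ := fun τ τ' h => by simpa using h
  calc {τ | σ ++ false :: τ ∈ (F : Set (List Bool))}.encard
      ≤ (F : Set (List Bool)).encard := by
        rw [← hinj.encard_image]
        exact Set.encard_le_encard (Set.image_preimage_subset _ _)
    _ ≤ s := by rw [Set.encard_coe_eq_coe_finsetCard]; exact_mod_cast hF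

theorem mem_cone_append_singleton {σ τ : List Bool} {b : Bool} :
    τ ∈ cone (σ ++ [b]) ↔ ∃ δ, τ = σ ++ b :: δ := by
  simp only [cone, Set.mem_ofPred_eq, List.IsPrefix, List.append_assoc, List.singleton_append,
    eq_comm]

theorem cone_diff_singleton (σ : List Bool) :
    cone σ \ {σ} = cone (σ ++ [false]) ∪ cone (σ ++ [true]) := by
  ext τ
  simp only [Set.mem_union, mem_cone_append_singleton]
  constructor
  · rintro ⟨⟨_ | ⟨_ | _, δ⟩, rfl⟩, hτ⟩
    · exact absurd (List.append_nil σ) hτ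
    · exact Or.inl ⟨δ, rfl⟩
    · exact Or.inr ⟨δ, rfl⟩
  · rintro (⟨δ, rfl⟩ | ⟨δ, rfl⟩) <;> exact ⟨List.prefix_append σ _, by simp⟩

theorem isAntichain_of_isRightComb {X : Set (List Bool)} (hX : IsRightComb X) :
    IsAntichain (· <+: ·) X := by
  induction hX with
  | subsingleton X hX => exact hX.isAntichain _
  | step X σ hX h0 _ ih =>
    obtain ⟨τ, hτ⟩ := h0
    intro ρ hρ ρ' hρ' hne hpre
    rcases (cone_diff_singleton σ).subset (hX hρ) with hc | hc
    · have hτρ : ∀ ρ ∈ X, ρ ∈ cone (σ ++ [false]) → ρ = τ := fun ρ hρ hc =>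
        hτ.subset ⟨hρ, hc⟩
      exact hne ((hτρ ρ hρ hc).trans (hτρ ρ' hρ' (hc.trans hpre)).symm)
    · exact ih ⟨hρ, hc⟩ ⟨hρ', hc.trans hpre⟩ hne hpre

theorem isLeftBounded_one_of_isRightComb {X : Set (List Bool)} (hX : IsRightComb X) :
    IsLeftBounded 1 X := by
  have hfib : ∀ (σ : List Bool) (Y : Set (List Bool)), Y.Subsingleton →
      {τ | σ ++ false :: τ ∈ Y}.encard ≤ (1 : ℕ) := fun σ Y hY =>
    Set.encard_le_one_iff_subsingleton.2 fun τ hτ τ' hτ' => by simpa using hY hτ hτ'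
  induction hX with
  | subsingleton X hX => exact fun σ _ _ => hfib σ X hX
  | step X σ hX h0 _ ih =>
    obtain ⟨ρ₀, hρ₀⟩ := h0
    intro ρ τ hτ
    have hfib0 : (∀ τ', ρ ++ false :: τ' ∈ X → ρ ++ false :: τ' ∈ cone (σ ++ [false])) →
        {τ' | ρ ++ false :: τ' ∈ X}.encard ≤ (1 : ℕ) := fun h =>
      (hfib ρ {ρ₀} Set.subsingleton_singleton).trans'
        (Set.encard_le_encard fun τ' hτ' => hρ₀.subset ⟨hτ', h τ' hτ'⟩)
    rcases List.prefix_or_prefix_of_prefix (hX hτ).1 (List.prefix_append ρ _) with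
      ⟨_ | ⟨_ | _, δ⟩, rfl⟩ | ⟨_ | ⟨_ | _, δ⟩, rfl⟩
    · exact hfib0 fun τ' _ => mem_cone_append_singleton.2 ⟨τ', by simp⟩
    · exact hfib0 fun τ' _ => mem_cone_append_singleton.2 ⟨δ ++ false :: τ', by simp⟩
    · have hcone : ∀ b τ', σ ++ true :: δ ++ b :: τ' ∈ cone (σ ++ [true]) := fun b τ' =>
        mem_cone_append_singleton.2 ⟨δ ++ b :: τ', by simp⟩
      exact (ih _ τ ⟨hτ, hcone true τ⟩).trans'
        (Set.encard_le_encard fun τ' hτ' => ⟨hτ', hcone false τ'⟩)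
    · exact hfib0 fun τ' _ => mem_cone_append_singleton.2 ⟨τ', by simp⟩
    · simpa [cone] using (hX hτ).1
    · refine hfib0 fun τ' hτ' => ?_
      simpa [cone] using (hX hτ').1

variable {α : Type*} {A : Set M} {V W : Ultrafilter (α → M)}

/-- The tree with root `e` whose two halves are the trees `f false` and `f true`. -/
def graft (e : α → M) (f : Bool → List Bool → α → M) : List Bool → α → M
  | [] => e
  | b :: σ => f b σ

variable {e : α → M} {f : Bool → List Bool → α → M} {X : Set (List Bool)}

theorem isMorleyOn_graft_of_isChain (hX : IsChain (· <+: ·) X)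
    (he : Realizes L V (A ∪ ⋃ b, coords (f b) {σ | b :: σ ∈ X}) e)
    (hf : ∀ b, IsMorleyOn L V A (· > ·) (f b) {σ | b :: σ ∈ X}) :
    IsMorleyOn L V A (· > ·) (graft e f) X := by
  rintro (_ | ⟨b, σ⟩) hσ
  · refine he.mono (Set.union_subset_union_right A (Set.iUnion₂_subset ?_))
    rintro (_ | ⟨b, τ⟩) ⟨hτ, hτσ⟩
    · exact absurd hτσ (lt_irrefl _)
    · exact fun y hy => Set.mem_iUnion.2 ⟨b, Set.mem_biUnion (show b :: τ ∈ X from hτ) hy⟩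
  · refine (hf b σ hσ).mono (Set.union_subset_union_right A (Set.iUnion₂_subset ?_))
    rintro (_ | ⟨b', τ⟩) ⟨hτ, hτσ⟩
    · exact absurd hτσ (List.not_lt_nil _)
    · obtain rfl : b' = b := by
        rcases hX.total hτ hσ with h | h
        exacts [(List.cons_prefix_cons.1 h).1, (List.cons_prefix_cons.1 h).1.symm]
      exact range_subset_coords (X := {τ ∈ {τ | b' :: τ ∈ X} | τ > σ})
        ⟨hτ, List.cons_lt_cons_self.1 hτσ⟩

theorem isMorleyOn_graft_of_nil_notMem (hX : [] ∉ X)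
    (h1 : IsMorleyOn L W A (· > ·) (f true) {σ | true :: σ ∈ X})
    (h0 : IsMorleyOn L W (A ∪ coords (f true) {σ | true :: σ ∈ X}) (· > ·) (f false)
      {σ | false :: σ ∈ X}) :
    IsMorleyOn L W A (· > ·) (graft e f) X := by
  rintro (_ | ⟨_ | _, σ⟩) hσ
  · exact absurd hσ hX
  · refine (h0 σ hσ).mono ?_
    rw [Set.union_assoc]
    refine Set.union_subset_union_right A (Set.iUnion₂_subset ?_)
    rintro (_ | ⟨_ | _, τ⟩) ⟨hτ, hτσ⟩
    · exact absurd hτ hX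
    · exact (range_subset_coords (X := {τ ∈ {τ | false :: τ ∈ X} | τ > σ})
        ⟨hτ, List.cons_lt_cons_self.1 hτσ⟩).trans Set.subset_union_right
    · exact (range_subset_coords (X := {τ | true :: τ ∈ X}) hτ).trans Set.subset_union_left
  · refine (h1 σ hσ).mono (Set.union_subset_union_right A (Set.iUnion₂_subset ?_))
    rintro (_ | ⟨_ | _, τ⟩) ⟨hτ, hτσ⟩
    · exact absurd hτ hX
    · exact absurd hτσ (by simp [List.cons_lt_cons_iff])
    · exact range_subset_coords (X := {τ ∈ {τ | true :: τ ∈ X} | τ > σ})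
        ⟨hτ, List.cons_lt_cons_self.1 hτσ⟩

end BinaryTrees

section TreeConstruction

variable {n s : ℕ} {A : Set M} {V W : Ultrafilter (Fin n → M)} {X : Set (List Bool)}

theorem isChain_setOf_cons_mem (hX : IsChain (· <+: ·) X) (b : Bool) :
    IsChain (· <+: ·) {σ | b :: σ ∈ X} := fun _ hσ _ hτ hne =>
  (hX hσ hτ (by simpa using hne)).imp (fun h => (List.cons_prefix_cons.1 h).2)
    fun h => (List.cons_prefix_cons.1 h).2

theorem isAntichain_setOf_cons_mem (hX : IsAntichain (· <+: ·) X) (b : Bool) :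
    IsAntichain (· <+: ·) {σ | b :: σ ∈ X} := fun _ hσ _ hτ hne hpre =>
  hX hσ hτ (by simpa using hne) (List.cons_prefix_cons.2 ⟨rfl, hpre⟩)

theorem IsLeftBounded.setOf_cons_mem (hX : IsLeftBounded s X) (b : Bool) :
    IsLeftBounded s {σ | b :: σ ∈ X} := fun σ => hX (b :: σ)

theorem isMorleyOn_graft_of_isAntichain (hX : IsAntichain (· <+: ·) X) {e : Fin n → M}
    (he : Realizes L W A e) {g : Bool → List Bool → Fin n → M}
    (hg : ∀ b, IsMorleyOn L W A (· > ·) (g b) {σ | b :: σ ∈ X})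
    (hg' : ∀ τ, true :: τ ∈ X → IsMorleyOn L W (A ∪ coords (g true) {σ | true :: σ ∈ X})
      (· > ·) (g false) {σ | false :: σ ∈ X}) :
    IsMorleyOn L W A (· > ·) (graft e g) X := by
  by_cases hnil : [] ∈ X
  · obtain rfl : X = {[]} := by
      refine Set.eq_singleton_iff_unique_mem.2 ⟨hnil, fun σ hσ => ?_⟩
      by_contra hne
      exact hX hnil hσ (Ne.symm hne) List.nil_prefix
    exact isMorleyOn_singleton.2 he
  · refine isMorleyOn_graft_of_nil_notMem hnil (hg true) ?_
    rcases {σ | true :: σ ∈ X}.eq_empty_or_nonempty with hempty | ⟨τ, hτ⟩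
    · simpa only [hempty, coords, Set.biUnion_empty, Set.union_empty] using hg false
    · exact hg' τ hτ

/-- The part of the tree `f` of height less than `d` consists of Morley sequences: its chains are
generated by `V` and its antichains left-bounded by `s` are generated by `W`, both over `A`. -/
def IsMorleyTree (L : FirstOrder.Language.{u, v}) {M : Type w} [L.Structure M] {α : Type*}
    (V W : Ultrafilter (α → M)) (A : Set M) (s d : ℕ) (f : List Bool → α → M) : Prop :=
  ∀ X ⊆ {σ | σ.length < d},
    (IsChain (· <+: ·) X → IsMorleyOn L V A (· > ·) f X) ∧
    (IsAntichain (· <+: ·) X → IsLeftBounded s X → IsMorleyOn L W A (· > ·) f X)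

theorem IsMorleyTree.graft (hV : IsInvariantUltrafilter L A V) (hW : IsInvariantUltrafilter L A W)
    (hVW : ∀ t, A.Definable L t → (t ∈ V ↔ t ∈ W)) {d : ℕ} {f : List Bool → Fin n → M}
    (hf : IsMorleyTree L V W A s d f) {B : Set M} (hB : coords f {σ | σ.length < d} ⊆ B)
    {π : M → M} (hπ : IsElementaryOn L A B π)
    (hπs : ∀ X : Set (List Bool), X.Finite → X.ncard ≤ s → coords f X ⊆ B →
      IsMorleyOn L W A (· > ·) f X → IsMorleyOn L W (A ∪ π '' B) (· > ·) f X)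
    {e : Fin n → M} (he : Realizes L V (A ∪ (B ∪ π '' B)) e) :
    IsMorleyTree L V W A s (d + 1) (graft e fun b σ => cond b π id ∘ f σ) := by
  intro X hX
  have hXd : ∀ b, {σ | b :: σ ∈ X} ⊆ {σ | σ.length < d} := fun b σ hσ =>
    Nat.lt_of_succ_lt_succ (hX hσ)
  have hXB : ∀ b, coords f {σ | b :: σ ∈ X} ⊆ B := fun b => (coords_mono (hXd b)).trans hB
  have hcoords : ∀ b, coords (fun σ => cond b π id ∘ f σ) {σ | b :: σ ∈ X} ⊆ cond b π id '' B :=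
    fun b => Set.iUnion₂_subset fun σ hσ => Set.range_subset_iff.2 fun j =>
      Set.mem_image_of_mem _ (hXB b (mem_coords hσ j))
  have hmap : ∀ U : Ultrafilter (Fin n → M), IsInvariantUltrafilter L A U → ∀ b,
      IsMorleyOn L U A (· > ·) f {σ | b :: σ ∈ X} →
        IsMorleyOn L U A (· > ·) (fun σ => cond b π id ∘ f σ) {σ | b :: σ ∈ X} := by
    rintro U hU (_ | _) h
    · exact h
    · exact h.map hU hπ (hXB true)
  refine ⟨fun hchain => ?_, fun hanti hleft => ?_⟩
  · refine isMorleyOn_graft_of_isChain hchain (he.mono ?_) fun b =>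
      hmap V hV b ((hf _ (hXd b)).1 (isChain_setOf_cons_mem hchain b))
    refine Set.union_subset_union_right A (Set.iUnion_subset ?_)
    rintro (_ | _)
    · exact (hcoords false).trans (by simp)
    · exact (hcoords true).trans Set.subset_union_right
  have hfW : ∀ b, IsMorleyOn L W A (· > ·) f {σ | b :: σ ∈ X} := fun b =>
    (hf _ (hXd b)).2 (isAntichain_setOf_cons_mem hanti b) (hleft.setOf_cons_mem b)
  refine isMorleyOn_graft_of_isAntichain hanti
    (fun t ht => (he.mono Set.subset_union_left t ht).trans (hVW t ht))
    (fun b => hmap W hW b (hfW b)) fun τ hτ => ?_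
  have hX0 := (List.finite_length_lt Bool d).subset (hXd false)
  have hcard : {σ | false :: σ ∈ X}.encard ≤ s := hleft [] τ hτ
  rw [← hX0.cast_ncard_eq, Nat.cast_le] at hcard
  exact (hπs _ hX0 hcard (hXB false) (hfW false)).mono
    (Set.union_subset_union_right A (hcoords true)) subset_rfl

theorem exists_isMorleyTree [Nonempty M] {μ : Cardinal.{w}} (hμ : ℵ₀ ≤ μ)
    (hM : L.IsSaturated μ M) (hA : #A < μ) (hV : IsInvariantUltrafilter L A V)
    (hW : IsInvariantUltrafilter L A W) (hVW : ∀ t, A.Definable L t → (t ∈ V ↔ t ∈ W))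
    (hWs : IsReversible L A W s) (d : ℕ) : ∃ f, IsMorleyTree L V W A s d f := by
  induction d with
  | zero =>
    refine ⟨fun _ _ => Classical.arbitrary M, fun X hX => ?_⟩
    obtain rfl : X = ∅ := Set.eq_empty_of_forall_notMem fun σ hσ => Nat.not_lt_zero _ (hX hσ)
    exact ⟨fun _ _ h => h.elim, fun _ _ _ h => h.elim⟩
  | succ d ih =>
    obtain ⟨f, hf⟩ := ih
    have hB : (coords f {σ | σ.length < d}).Finite := finite_coords (List.finite_length_lt Bool d)
    obtain ⟨π, hπ, hπs⟩ := exists_isElementaryOn_isMorleyOn (r := fun σ τ : List Bool => σ > τ)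
      hμ hM hA hW hWs hB
    obtain ⟨e, he⟩ := exists_realizes_of_isSaturated hM
      (mk_union_lt_of_finite hμ hA (hB.union (hB.image π))) V
    exact ⟨_, hf.graft hV hW hVW subset_rfl hπ (hπs f) he⟩

end TreeConstruction

section Compactness

theorem exists_model_realize_of_eventually (T : L.Theory) [Nonempty M] [M ⊨ T] {δ : Type*}
    {γ : Type} (l : Filter δ) [l.NeBot] (v : δ → γ → M) :
    ∃ (𝓜 : Theory.ModelType.{u, v, max u v} T) (v' : γ → 𝓜), ∀ θ : L.Formula γ,
      (∀ᶠ d in l, θ.Realize (v d)) → θ.Realize v' := by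
  let U : Ultrafilter δ := Ultrafilter.of l
  let 𝓤 := (U : Filter δ).Product fun _ => M
  have : Nonempty 𝓤 := Ultraproduct.Product.instNonempty
  have : 𝓤 ⊨ T := ⟨fun θ hθ => (Ultraproduct.sentence_realize (u := U) (M := fun _ => M) θ).2
    (Filter.Eventually.of_forall fun _ => Theory.realize_sentence_of_mem T hθ)⟩
  let v' : γ → 𝓤 := fun i => ((fun d => v d i : δ → M) : (U : Filter δ).Product fun _ => M)
  obtain ⟨𝓜, x, hx⟩ := Theory.exists_modelType_is_realized_in T (Theory.typeOf T v')
  refine ⟨𝓜, x, fun θ hθ => ?_⟩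
  rw [← Theory.CompleteType.formula_mem_typeOf (T := T), hx,
    Theory.CompleteType.formula_mem_typeOf]
  exact (Ultraproduct.realize_formula_cast (u := U) (M := fun _ => M) θ fun i d => v d i).2
    (Ultrafilter.of_le l hθ)

variable {α β ι : Type*} [Finite α]

/-- The formula in the variables `(y i)_{i}` expressing that `{φ(x, y i) : i ∈ F}` is consistent. -/
noncomputable def consistencyFormula (φ : L.Formula (α ⊕ β)) (F : Finset ι) : L.Formula (ι × β) :=
  Formula.iExs α (BoundedFormula.iInf fun i : F =>
    (φ.relabel (Sum.elim Sum.inr fun j => Sum.inl (i.1, j)) : L.Formula ((ι × β) ⊕ α)))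

theorem realize_consistencyFormula (φ : L.Formula (α ⊕ β)) (F : Finset ι) (y : ι × β → M) :
    (consistencyFormula φ F).Realize y ↔
      ∃ x : α → M, ∀ i ∈ F, φ.Realize (Sum.elim x fun j => y (i, j)) := by
  have hφ : ∀ (x : α → M) (i : ι), (φ.relabel (Sum.elim Sum.inr fun j => Sum.inl (i, j)) :
      L.Formula ((ι × β) ⊕ α)).Realize (Sum.elim y x) ↔
        φ.Realize (Sum.elim x fun j => y (i, j)) := by
    intro x i
    rw [Formula.realize_relabel]
    refine iff_of_eq (congrArg φ.Realize ?_)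
    funext k
    rcases k with k | k <;> rfl
  rw [consistencyFormula, Formula.realize_iExs]
  refine exists_congr fun x => ?_
  rw [Formula.Realize, BoundedFormula.realize_iInf, Subtype.forall]
  exact forall₂_congr fun i _ => hφ x i

theorem length_pathRestrict (η : ℕ → Bool) (i : ℕ) : (pathRestrict η i).length = i :=
  List.length_ofFn

theorem pathRestrict_prefix (η : ℕ → Bool) {i j : ℕ} (hij : i ≤ j) :
    pathRestrict η i <+: pathRestrict η j := by
  refine List.prefix_iff_eq_take.2 (List.ext_getElem ?_ fun l _ _ => ?_)
  · simp [pathRestrict, hij]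
  · simp [pathRestrict]

theorem exists_model_tree (T : L.Theory) [Nonempty M] [M ⊨ T] {m n : ℕ}
    (φ : L.Formula (Fin m ⊕ Fin n)) {k : ℕ} {s : ℕ → ℕ}
    (h : ∀ d, ∃ f : List Bool → Fin n → M, ∀ F : Finset (List Bool), (∀ σ ∈ F, σ.length < d) →
      (IsChain (· <+: ·) (F : Set (List Bool)) → F.card = k →
        ¬ ∃ x : Fin m → M, ∀ σ ∈ F, φ.Realize (Sum.elim x (f σ))) ∧
      (IsAntichain (· <+: ·) (F : Set (List Bool)) → IsLeftBounded (s d) (F : Set (List Bool)) →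
        ∃ x : Fin m → M, ∀ σ ∈ F, φ.Realize (Sum.elim x (f σ)))) :
    ∃ (𝓜 : Theory.ModelType.{u, v, max u v} T) (b : List Bool → Fin n → 𝓜),
      (∀ η : ℕ → Bool, IsKInconsistent φ (fun i => b (pathRestrict η i)) k) ∧
      ∀ X : Set (List Bool), IsAntichain (· <+: ·) X →
        (∀ F : Finset (List Bool), (F : Set (List Bool)) ⊆ X →
          ∀ᶠ d in Filter.atTop, IsLeftBounded (s d) (F : Set (List Bool))) →
        IsConsistentOn φ b X := by
  classical
  choose f hf using h
  obtain ⟨𝓜, v, hv⟩ := exists_model_realize_of_eventually T Filter.atTop fun d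
    (p : List Bool × Fin n) => f d p.1 p.2
  have hlen : ∀ F : Finset (List Bool), ∀ᶠ d in Filter.atTop, ∀ σ ∈ F, σ.length < d := fun F =>
    (Filter.eventually_all_finset F).2 fun σ _ => Filter.eventually_gt_atTop σ.length
  refine ⟨𝓜, fun σ j => v (σ, j), fun η F hF => ?_, fun X hX hs F hFX => ?_⟩
  · have hinj : Function.Injective (pathRestrict η) := fun i j hij => by
      rw [← length_pathRestrict η i, hij, length_pathRestrict]
    have hchain : IsChain (· <+: ·) (F.image (pathRestrict η) : Set (List Bool)) := by
      rw [Finset.coe_image]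
      rintro _ ⟨i, -, rfl⟩ _ ⟨j, -, rfl⟩ -
      exact (le_total i j).imp (pathRestrict_prefix η) (pathRestrict_prefix η)
    have hv' := hv (consistencyFormula φ (F.image (pathRestrict η))).not
      ((hlen (F.image (pathRestrict η))).mono fun d hd => by
        rw [Formula.realize_not, realize_consistencyFormula]
        exact (hf d _ hd).1 hchain ((Finset.card_image_of_injective F hinj).trans hF))
    simpa only [Formula.realize_not, realize_consistencyFormula, Finset.forall_mem_image] using hv'
  · refine (realize_consistencyFormula φ F v).1 (hv _ ?_)
    filter_upwards [hlen F, hs F hFX] with d hd hsd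
    exact (realize_consistencyFormula φ F _).2 ((hf d F hd).2 (hX.subset hFX) hsd)

end Compactness

section BiInvariance

variable {n s : ℕ} {A B : Set M} {W : Ultrafilter (Fin n → M)} {p : GlobalType L M (Fin n)}

theorem Represents.isMorleyOn_univ_iff {α ι : Type} {W : Ultrafilter (α → M)}
    {p : GlobalType L M α} (hW : Represents W p) {r : ι → ι → Prop} {e : ι → α → M} :
    IsMorleyOn L W B r e Set.univ ↔
      ∀ i, p.RealizedOver (B ∪ ⋃ j, ⋃ (_ : r j i), Set.range (e j)) (e i) := by
  simp only [IsMorleyOn, hW.realizes_iff, coords, Set.mem_univ, true_and, Set.mem_ofPred_eq,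
    true_imp_iff]

theorem exists_isMorleyOn_Iio [Nonempty M] {μ : Cardinal.{w}} (hμ : ℵ₀ ≤ μ)
    (hM : L.IsSaturated μ M) (hA : #A < μ) (W : Ultrafilter (Fin n → M)) (s : ℕ) :
    ∃ E, IsMorleyOn L W A (· < ·) E (Set.Iio s) := by
  induction s with
  | zero => exact ⟨fun _ _ => Classical.arbitrary M, fun i hi => absurd hi (Nat.not_lt_zero i)⟩
  | succ s ih =>
    obtain ⟨E, hE⟩ := ih
    obtain ⟨e, he⟩ := exists_realizes_of_isSaturated hM
      (mk_union_lt_of_finite hμ hA (finite_coords (e := E) (Set.finite_Iio s))) W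
    have hcoords : ∀ i ≤ s, coords (Function.update E s e) {j ∈ Set.Iio (s + 1) | j < i} ⊆
        coords E {j ∈ Set.Iio s | j < i} := fun i hi => Set.iUnion₂_subset fun j hj => by
      have hjs : j < s := hj.2.trans_le hi
      rw [Function.update_of_ne hjs.ne]
      exact range_subset_coords (X := {j ∈ Set.Iio s | j < i}) ⟨hjs, hj.2⟩
    refine ⟨Function.update E s e, fun i hi => ?_⟩
    rcases (Nat.lt_succ_iff.1 hi).lt_or_eq with his | rfl
    · rw [Function.update_of_ne his.ne]
      exact (hE i his).mono (Set.union_subset_union_right A (hcoords i his.le))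
    · rw [Function.update_self]
      exact he.mono (Set.union_subset_union_right A
        ((hcoords i le_rfl).trans (coords_mono (Set.sep_subset _ _))))

theorem isReversible_of_isBiInvariant [Nonempty M] {μ : Cardinal.{w}} (hμ : ℵ₀ ≤ μ)
    (hM : L.IsSaturated μ M) (hA : #A < μ) (hW : Represents W p) (hp : p.IsBiInvariant A) :
    IsReversible L A W 1 := by
  intro k b
  obtain ⟨e, he⟩ := exists_realizes_of_isSaturated hM
    (mk_union_lt_of_finite hμ hA (Set.finite_range b)) W
  obtain ⟨q, hq, hqb⟩ := hp.2 e k b (hW.realizes_iff.1 he)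
  obtain ⟨U, hU⟩ := exists_represents q
  have hIio : Set.Iio 1 = {0} := by ext; simp
  refine ⟨fun _ => e, ?_, U, hU.isInvariantUltrafilter_iff.2 hq, hU.realizes_iff.2 ?_⟩
  · rw [hIio]
    exact isMorleyOn_singleton.2 he
  · rwa [hIio, coords, Set.biUnion_singleton]

theorem IsInvariantUltrafilter.mono (hW : IsInvariantUltrafilter L A W) (hAB : A ⊆ B) :
    IsInvariantUltrafilter L B W :=
  fun k ψ d d' hd => hW k ψ d d' (hd.mono hAB)

theorem realizedOver_of_isPower {r : GlobalType L M (Fin s × Fin n)} (hr : r.IsPower p A)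
    (hW : Represents W p) (hWA : IsInvariantUltrafilter L A W) (hAB : A ⊆ B) {a : Fin s → Fin n → M}
    (ha : IsMorleyOn L W B (· < ·) a Set.univ) :
    r.RealizedOver B fun ij => a ij.1 ij.2 := by
  intro k ψ d hd
  have hB : A ∪ Set.range d ⊆ B := Set.union_subset hAB (Set.range_subset_iff.2 hd)
  simp only [hr k ψ d, ← hW.isMorleyOn_univ_iff]
  refine ⟨?_, fun hψ => ⟨a, ha.mono hB subset_rfl, hψ⟩⟩
  rintro ⟨a', ha', hψ⟩
  have haa' := (ha'.sameType (hWA.mono Set.subset_union_left) Set.finite_univ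
    (ha.mono hB subset_rfl)).comp fun ij : Fin s × Fin n => (⟨ij.1, trivial⟩, ij.2)
  exact (haa' _ (definable_setOf_realize ψ fun j => Or.inr ⟨j, rfl⟩)).1 hψ

theorem isReversible_of_isStronglyBiInvariant [Nonempty M] {μ : Cardinal.{w}} (hμ : ℵ₀ ≤ μ)
    (hM : L.IsSaturated μ M) (hA : #A < μ) (hW : Represents W p)
    (hp : p.IsStronglyBiInvariant A) (s : ℕ) : IsReversible L A W s := by
  intro k b
  obtain ⟨E, hE⟩ := exists_isMorleyOn_Iio hμ hM
    (mk_union_lt_of_finite hμ hA (Set.finite_range b)) W s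
  obtain ⟨r, hr, hrA⟩ := hp.2 s
  have hEs : IsMorleyOn L W (A ∪ Set.range b) (· < ·) (E ∘ Fin.val) (Set.univ : Set (Fin s)) :=
    hE.comp (fun i _ => i.2) fun i _ j _ h => h
  obtain ⟨q, hq, hqb⟩ := hrA.2 _ k b (realizedOver_of_isPower hr hW
    (hW.isInvariantUltrafilter_iff.2 hp.1) Set.subset_union_left hEs)
  obtain ⟨U, hU⟩ := exists_represents q
  refine ⟨E, hE, U, hU.isInvariantUltrafilter_iff.2 hq, hU.realizes_iff.2 ?_⟩
  convert hqb using 2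
  ext y
  simp [coords, Fin.exists_iff]

theorem exists_realize_of_not_kimDivides {m : ℕ} {ι : Type} {r : ι → ι → Prop}
    [IsStrictTotalOrder ι r] (hW : Represents W p) (hp : p.IsInvariant A)
    {φ : L.Formula (Fin m ⊕ Fin n)} (hφ : ¬ p.KimDivides A φ) {F : Finset ι} {e : ι → Fin n → M}
    (he : IsMorleyOn L W A r e F) : ∃ x : Fin m → M, ∀ i ∈ F, φ.Realize (Sum.elim x (e i)) := by
  simp only [GlobalType.KimDivides, not_forall, not_not] at hφ
  obtain ⟨E, hE, hcons⟩ := hφ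
  have hEW : IsMorleyOn L W A (· < ·) E Set.univ := hW.isMorleyOn_univ_iff.2 hE
  obtain ⟨g, -, -, hg⟩ := he.exists_sameType_comp (hW.isInvariantUltrafilter_iff.2 hp)
    F.finite_toSet (hEW.mono subset_rfl (Set.subset_univ _)) subset_rfl
  classical
  obtain ⟨x, hx⟩ := hcons (F.image g) (Set.subset_univ _)
  have hdef : A.Definable L {z : ↥(F : Set ι) × Fin n → M |
      (consistencyFormula φ Finset.univ).Realize z} :=
    (Set.empty_definable_iff.2 ⟨_, rfl⟩ : (∅ : Set M).Definable L _).mono (Set.empty_subset A)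
  have hEg : ∃ x, ∀ i ∈ (Finset.univ : Finset ↥(F : Set ι)),
      φ.Realize (Sum.elim x fun j => tupleOn (E ∘ g) ↑F (i, j)) :=
    ⟨x, fun i _ => hx (g i) (Finset.mem_image_of_mem g i.2)⟩
  obtain ⟨x, hx⟩ := (realize_consistencyFormula φ _ _).1
    ((hg _ hdef).1 ((realize_consistencyFormula φ _ _).2 hEg))
  exact ⟨x, fun i hi => hx ⟨i, hi⟩ (Finset.mem_univ _)⟩

end BiInvariance

section Parameters

variable {α β γ P : Type*}

theorem apply_eq_of_term_relabel_eq [DecidableEq α] {f f' : α ⊕ β → γ} {t : L.Term (α ⊕ β)}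
    (h : t.relabel f = t.relabel f') {a : α} (ha : a ∈ t.varFinsetLeft) :
    f (Sum.inl a) = f' (Sum.inl a) := by
  induction t with
  | var i =>
    rcases i with i | i
    · rw [Term.varFinsetLeft, Finset.mem_singleton] at ha
      subst ha
      exact Term.var.inj h
    · exact absurd ha (Finset.notMem_empty a)
  | func F ts ih =>
    rw [Term.varFinsetLeft, Finset.mem_biUnion] at ha
    obtain ⟨i, -, hi⟩ := ha
    simp only [Term.relabel, Term.func.injEq, heq_eq_eq, true_and] at h
    exact ih i (congrFun h i) hi

theorem apply_eq_of_relabel_eq [DecidableEq α] {n k : ℕ} {g g' : α → β ⊕ Fin n}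
    {φ : L.BoundedFormula α k} (h : φ.relabel g = φ.relabel g') {a : α}
    (ha : a ∈ φ.freeVarFinset) : g a = g' a := by
  have hinj : ∀ k, BoundedFormula.relabelAux g k (Sum.inl a) =
      BoundedFormula.relabelAux g' k (Sum.inl a) → g a = g' a := fun k h =>
    Sum.inl_injective ((Equiv.sumAssoc β (Fin n) (Fin k)).injective
      ((Function.injective_id.sumMap finSumFinEquiv.injective) h))
  induction φ with
  | falsum => exact absurd ha (Finset.notMem_empty a)
  | equal t₁ t₂ =>
    simp only [BoundedFormula.relabel, BoundedFormula.mapTermRel,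
      BoundedFormula.equal.injEq] at h
    exact (Finset.mem_union.1 ha).elim (fun ha => hinj _ (apply_eq_of_term_relabel_eq h.1 ha))
      fun ha => hinj _ (apply_eq_of_term_relabel_eq h.2 ha)
  | rel R ts =>
    simp only [BoundedFormula.relabel, BoundedFormula.mapTermRel, BoundedFormula.rel.injEq,
      heq_eq_eq, true_and] at h
    obtain ⟨i, -, hi⟩ := Finset.mem_biUnion.1 ha
    exact hinj _ (apply_eq_of_term_relabel_eq (congrFun h i) hi)
  | imp φ ψ ihφ ihψ =>
    simp only [BoundedFormula.relabel_imp, BoundedFormula.imp.injEq] at h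
    exact (Finset.mem_union.1 ha).elim (ihφ h.1) (ihψ h.2)
  | all φ ih =>
    simp only [BoundedFormula.relabel_all, BoundedFormula.all.injEq] at h
    exact ih h ha

theorem apply_eq_of_plug_eq [DecidableEq (α ⊕ β)] {φ : L.Formula (α ⊕ β)} {c c' : β → P}
    (h : φ.plug c = φ.plug c') {j : β} (hj : Sum.inr j ∈ BoundedFormula.freeVarFinset φ) :
    c j = c' j :=
  Sum.inl_injective (Sum.inl_injective
    (apply_eq_of_relabel_eq (BoundedFormula.constantsVarsEquiv.symm.injective h) hj))

end Parameters

section DualTypes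

variable {α : Type} {ι β : Type*} {N : L.ElementarySubstructure M} {Γ : Set (L[[N]].Formula α)}
  {φ : L.Formula (α ⊕ β)} {k : ℕ}

/-- The parameter tuples of the instances of `φ(x, y)` in `Γ(x)`, regarded as tuples in the
ambient structure. -/
def dualTypeParams (Γ : Set (L[[N]].Formula α)) (φ : L.Formula (α ⊕ β)) : Set (β → M) :=
  (fun c j => (c j : M)) '' {c : β → N | φ.plug c ∈ Γ}

theorem not_exists_realize_of_mapsTo_dualTypeParams [Finite α] [DecidableEq (α ⊕ β)]
    (hΓ : ∀ F : Finset (L[[N]].Formula α), (F : Set (L[[N]].Formula α)) ⊆ Γ → F.card = k →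
      ¬ ∃ x : α → N, ∀ θ ∈ F, θ.Realize x)
    {j : β} (hj : Sum.inr j ∈ BoundedFormula.freeVarFinset φ) {F : Finset ι} (hF : F.card = k)
    {e : ι → β → M} (he : Set.MapsTo e F (dualTypeParams Γ φ))
    (hinj : Set.InjOn (fun i => e i j) F) :
    ¬ ∃ x : α → M, ∀ i ∈ F, φ.Realize (Sum.elim x (e i)) := by
  classical
  rintro ⟨x, hx⟩
  choose c hcΓ hc using fun i : F => he i.2
  have hplug : Function.Injective fun i => φ.plug (c i) := fun i i' h => Subtype.ext <|
    hinj i.2 i'.2 <| by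
      simp only [← hc, apply_eq_of_plug_eq h hj]
  have hM : (consistencyFormula φ F.attach).Realize
      (N.subtype ∘ fun p : F × β => c p.1 p.2) :=
    (realize_consistencyFormula φ _ _).2 ⟨x, fun i _ =>
      (congrArg (fun e => φ.Realize (Sum.elim x e)) (hc i)).mpr (hx i i.2)⟩
  obtain ⟨y, hy⟩ := (realize_consistencyFormula φ _ _).1 ((N.subtype.map_formula _ _).1 hM)
  refine hΓ (F.attach.image fun i => φ.plug (c i)) ?_ ?_ ⟨y, ?_⟩
  · simp only [Finset.coe_image, Set.image_subset_iff]
    exact fun i _ => hcΓ i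
  · rw [Finset.card_image_of_injective _ hplug, Finset.card_attach, hF]
  · simp only [Finset.forall_mem_image, Formula.realize_plug]
    exact hy

theorem IsMorleyOn.not_exists_realize [Finite α] {β : Type} [DecidableEq (α ⊕ β)]
    {φ : L.Formula (α ⊕ β)}
    (hΓ : ∀ F : Finset (L[[N]].Formula α), (F : Set (L[[N]].Formula α)) ⊆ Γ → F.card = k →
      ¬ ∃ x : α → N, ∀ θ ∈ F, θ.Realize x)
    {j : β} (hj : Sum.inr j ∈ BoundedFormula.freeVarFinset φ) {A : Set M}
    {V : Ultrafilter (β → M)} (hV : {c ∈ dualTypeParams Γ φ | ∀ j, c j ∈ A} ∈ V)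
    (hVj : ∀ a, {c | c j ≠ a} ∈ V) {r : ι → ι → Prop} [IsStrictTotalOrder ι r] {e : ι → β → M}
    {F : Finset ι} (hF : F.card = k) (he : IsMorleyOn L V A r e F) :
    ¬ ∃ x : α → M, ∀ i ∈ F, φ.Realize (Sum.elim x (e i)) := by
  rintro ⟨x, hx⟩
  let S : Set (↥(F : Set ι) × β → M) := {z | (consistencyFormula φ Finset.univ).Realize z} ∩
    ⋂ p : {p : ↥(F : Set ι) × ↥(F : Set ι) // p.1 ≠ p.2}, {z | z (p.1.1, j) = z (p.1.2, j)}ᶜ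
  have hS : A.Definable L S :=
    ((Set.empty_definable_iff.2 ⟨_, rfl⟩ : (∅ : Set M).Definable L _).mono
      (Set.empty_subset A)).inter
        (Set.definable_iInter_of_finite fun _ => (definable_setOf_apply_eq _ _).compl)
  have heS : tupleOn e F ∈ S :=
    ⟨(realize_consistencyFormula φ _ _).2 ⟨x, fun i _ => hx i i.2⟩,
      Set.mem_iInter.2 fun p h => p.2 (Subtype.ext (he.injOn_apply hVj p.1.1.2 p.1.2.2 h))⟩
  obtain ⟨_, ⟨c, hc, rfl⟩, hcons, hne⟩ :=
    he.finitelySatisfiableIn hV (fun c hc => hc.2) F.finite_toSet S hS heS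
  obtain ⟨x, hx⟩ := (realize_consistencyFormula φ _ _).1 hcons
  refine not_exists_realize_of_mapsTo_dualTypeParams hΓ hj hF (fun i hi => (hc hi).1)
    (fun i hi i' hi' h => ?_) ⟨x, fun i hi => hx ⟨i, hi⟩ (Finset.mem_univ _)⟩
  by_contra hii'
  exact Set.mem_iInter.1 hne ⟨(⟨i, hi⟩, ⟨i', hi'⟩), fun h => hii' (congrArg Subtype.val h)⟩ h

end DualTypes

section Clubs

theorem mk_formula_le (L : FirstOrder.Language.{u, v}) (α : Type) [Finite α] :
    #(L.Formula α) ≤ max ℵ₀ L.card := by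
  have hsigma : #(L.Formula α) ≤ #(Σ n, L.BoundedFormula α n) :=
    mk_le_of_injective (f := fun φ : L.Formula α => ⟨0, φ⟩)
      fun _ _ => eq_of_heq ∘ (Sigma.mk.inj · |>.2)
  refine hsigma.trans (BoundedFormula.card_le.trans (max_le (le_max_left _ _) ?_))
  refine add_le_of_le (le_max_left _ _) ?_ ?_
  · exact (lift_le_aleph0.2 mk_le_aleph0).trans (le_max_left _ _)
  · rw [lift_uzero]
    exact le_max_right _ _

theorem mk_sigma_formula_le (L : FirstOrder.Language.{u, v}) (m : ℕ) :
    #(Σ n, L.Formula (Fin m ⊕ Fin n)) ≤ max ℵ₀ L.card := by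
  rw [mk_sigma]
  refine (sum_le_sum _ _ fun n => mk_formula_le L (Fin m ⊕ Fin n)).trans ?_
  rw [sum_const, lift_uzero, mk_nat, lift_aleph0]
  exact mul_le_of_le (le_max_left _ _) (le_max_left _ _) le_rfl

theorem exists_subset_finitelySatisfiableIn {α : Type} [Finite α] (A : Set M)
    (P : Set (α → M)) : ∃ B ⊆ ⋃ c ∈ P, Set.range c, lift.{max u v} #B ≤ max ℵ₀ L[[A]].card ∧
      ∀ c ∈ P, FinitelySatisfiableIn L A {c' ∈ P | ∀ j, c' j ∈ B} c := by
  choose c hcP hc using fun θ : {θ : L[[A]].Formula α // ∃ c ∈ P, θ.Realize c} => θ.2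
  refine ⟨Set.range fun p : _ × α => c p.1 p.2, ?_, ?_, ?_⟩
  · rintro _ ⟨p, rfl⟩
    exact Set.mem_biUnion (hcP p.1) ⟨p.2, rfl⟩
  · have hrange := mk_range_le_lift
      (f := fun p : {θ : L[[A]].Formula α // ∃ c ∈ P, θ.Realize c} × α => c p.1 p.2)
    rw [lift_id'.{w, max u v w}, lift_umax.{w, max u v}] at hrange
    refine hrange.trans ?_
    rw [mk_prod, lift_uzero]
    refine mul_le_of_le (le_max_left _ _) ((mk_subtype_le _).trans (mk_formula_le _ α)) ?_
    exact (lift_le_aleph0.2 mk_le_aleph0).trans (le_max_left _ _)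
  · rintro a ha _ ⟨θ, rfl⟩ haθ
    let θ' : {θ : L[[A]].Formula α // ∃ c ∈ P, θ.Realize c} := ⟨θ, a, ha, haθ⟩
    exact ⟨c θ', ⟨hcP θ', fun j => ⟨(θ', j), rfl⟩⟩, hc θ'⟩

variable {κ : Cardinal.{w}} {ι : Type (max u v)} {α : ι → Type} [∀ i, Finite (α i)]

theorem exists_small_subset_finitelySatisfiableIn (hκ : ℵ₀ < κ)
    (hL : lift.{w} L.card < lift.{max u v} κ) (hι : lift.{w} #ι < lift.{max u v} κ) {A D : Set M}
    (hA : #A < κ) {P : ∀ i, Set (α i → M)} (hP : ∀ i, ∀ c ∈ P i, ∀ j, c j ∈ D) :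
    ∃ B ⊆ D, #B < κ ∧ ∀ i, ∀ c ∈ P i, FinitelySatisfiableIn L A {c' ∈ P i | ∀ j, c' j ∈ B} c := by
  choose B hBP hB hPB using fun i => exists_subset_finitelySatisfiableIn (L := L) A (P i)
  refine ⟨⋃ i, B i, ?_, ?_, fun i c hc s hs hcs => ?_⟩
  · refine Set.iUnion_subset fun i => (hBP i).trans (Set.iUnion₂_subset fun c hc => ?_)
    exact Set.range_subset_iff.2 (hP i c hc)
  · rw [← lift_lt.{w, max u v}]
    refine (mk_iUnion_le_lift B).trans_lt ((mul_le_mul_right (ciSup_le' hB) _).trans_lt ?_)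
    have hκ' : ℵ₀ < lift.{max u v} κ := aleph0_lt_lift.2 hκ
    refine mul_lt_of_lt hκ'.le hι (max_lt hκ' ?_)
    rw [card_withConstants]
    exact add_lt_of_lt hκ'.le hL (lift_lt.2 hA)
  · obtain ⟨c', ⟨hc', hc'B⟩, hc's⟩ := hPB i c hc s hs hcs
    exact ⟨c', ⟨hc', fun j => Set.mem_iUnion_of_mem i (hc'B j)⟩, hc's⟩

theorem exists_mem_club_finitelySatisfiableIn (hκ : ℵ₀ < κ)
    (hL : lift.{w} L.card < lift.{max u v} κ) (hι : lift.{w} #ι < lift.{max u v} κ)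
    {N : L.ElementarySubstructure M} {C : Set (L.ElementarySubstructure M)}
    (hC : IsClubOfSmall κ N C) {P : ∀ i, Set (α i → M)} (hP : ∀ i, ∀ c ∈ P i, ∀ j, c j ∈ N) :
    ∃ N' ∈ C, ∀ i, ∀ c ∈ P i,
      FinitelySatisfiableIn L (N' : Set M) {c' ∈ P i | ∀ j, c' j ∈ N'} c := by
  have hstep : ∀ N₀ : C, ∃ N₁ : C, (N₀ : L.ElementarySubstructure M) ≤ N₁ ∧ ∀ i, ∀ c ∈ P i,
      FinitelySatisfiableIn L (N₀.1 : Set M) {c' ∈ P i | ∀ j, c' j ∈ N₁.1} c := by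
    rintro ⟨N₀, hN₀⟩
    obtain ⟨B, hBN, hB, hPB⟩ := exists_small_subset_finitelySatisfiableIn hκ hL hι
      (hC.small N₀ hN₀) (D := (N : Set M)) hP
    obtain ⟨N₁, hN₁, hBN₁⟩ := hC.unbounded (N₀ ∪ B) (Set.union_subset (hC.le N₀ hN₀) hBN)
      ((mk_union_le _ _).trans_lt (add_lt_of_lt hκ.le (hC.small N₀ hN₀) hB))
    refine ⟨⟨N₁, hN₁⟩, Set.subset_union_left.trans hBN₁, fun i c hc s hs hcs => ?_⟩
    obtain ⟨c', ⟨hc', hc'B⟩, hc's⟩ := hPB i c hc s hs hcs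
    exact ⟨c', ⟨hc', fun j => hBN₁ (Or.inr (hc'B j))⟩, hc's⟩
  choose S hS hSP using hstep
  obtain ⟨N₀, hN₀, -⟩ := hC.unbounded ∅ (Set.empty_subset _) (by simpa using aleph0_pos.trans hκ)
  let f : ℕ → C := fun i => S^[i] ⟨N₀, hN₀⟩
  have hf : ∀ i, f (i + 1) = S (f i) := fun i => Function.iterate_succ_apply' S i _
  have hmono : Monotone fun i => (f i : L.ElementarySubstructure M) :=
    monotone_nat_of_le_succ fun i => hf i ▸ hS (f i)
  obtain ⟨N', hN', hN'f⟩ := hC.closed (Set.range fun i => (f i : L.ElementarySubstructure M))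
    (Set.range_subset_iff.2 fun i => (f i).2) (Set.range_nonempty _) hmono.isChain_range
    ((Set.countable_range _).le_aleph0.trans_lt hκ)
  rw [Set.biUnion_range] at hN'f
  refine ⟨N', hN', fun i c hc s hs hcs => ?_⟩
  rw [hN'f] at hs
  obtain ⟨k, hk⟩ := exists_definable_of_directed_iUnion
    (show Monotone fun i => ((f i).1 : Set M) from hmono).directed_le hs
  obtain ⟨c', ⟨hc', hc'f⟩, hc's⟩ := hSP (f k) i c hc s hk hcs
  refine ⟨c', ⟨hc', fun j => hN'f.ge (Set.mem_iUnion_of_mem (k + 1) ?_)⟩, hc's⟩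
  exact hf k ▸ hc'f j

end Clubs

section Trees

theorem setOf_apply_ne_mem_of_realizes {ι : Type*} {A : Set M} {V : Ultrafilter (ι → M)}
    {D : Set (ι → M)} (hD : D ∈ V) (hDA : ∀ c ∈ D, ∀ j, c j ∈ A) {c : ι → M}
    (hc : Realizes L V A c) {j : ι} (hj : c j ∉ A) (a : M) : {x | x j ≠ a} ∈ V := by
  by_cases ha : a ∈ A
  · have hdef : A.Definable L {x : ι → M | Sum.elim x (fun _ : Unit => a) (Sum.inl j) =
        Sum.elim x (fun _ : Unit => a) (Sum.inr ())}ᶜ :=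
      (definable_fiber (definable_setOf_apply_eq _ _) subset_rfl fun _ => ha).compl
    exact (hc _ hdef).1 fun h : c j = a => hj (h ▸ ha)
  · exact Filter.mem_of_superset hD fun x hx h => ha (h ▸ hDA x hx j)

variable (T : L.Theory) [Nonempty M] [M ⊨ T] {μ : Cardinal.{w}} {A : Set M}
  {N : L.ElementarySubstructure M} {m n k : ℕ} {Γ : Set (L[[N]].Formula (Fin m))}
  {φ : L.Formula (Fin m ⊕ Fin n)} {c : Fin n → M} {p : GlobalType L M (Fin n)}

theorem exists_model_tree_of_isReversible (hμ : ℵ₀ ≤ μ) (hM : L.IsSaturated μ M) (hA : #A < μ)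
    (hΓ : ∀ F : Finset (L[[N]].Formula (Fin m)), (F : Set (L[[N]].Formula (Fin m))) ⊆ Γ →
      F.card = k → ¬ ∃ x : Fin m → N, ∀ θ ∈ F, θ.Realize x)
    {j : Fin n} (hj : Sum.inr j ∈ BoundedFormula.freeVarFinset φ) (hcj : c j ∉ A)
    (hc : FinitelySatisfiableIn L A {c' ∈ dualTypeParams Γ φ | ∀ j, c' j ∈ A} c)
    (hp : p.IsInvariant A) (hpc : p.RealizedOver A c) (hφ : ¬ p.KimDivides A φ)
    {W : Ultrafilter (Fin n → M)} (hW : Represents W p) {s : ℕ → ℕ}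
    (hWs : ∀ d, IsReversible L A W (s d)) :
    ∃ (𝓜 : Theory.ModelType.{u, v, max u v} T) (b : List Bool → Fin n → 𝓜),
      (∀ η : ℕ → Bool, IsKInconsistent φ (fun i => b (pathRestrict η i)) k) ∧
      ∀ X : Set (List Bool), IsAntichain (· <+: ·) X →
        (∀ F : Finset (List Bool), (F : Set (List Bool)) ⊆ X →
          ∀ᶠ d in Filter.atTop, IsLeftBounded (s d) (F : Set (List Bool))) →
        IsConsistentOn φ b X := by
  obtain ⟨V, hV, hVc⟩ := hc.exists_ultrafilter
  have hVj := setOf_apply_ne_mem_of_realizes hV (fun c hc => hc.2) hVc hcj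
  have hVA : IsInvariantUltrafilter L A V := isInvariantUltrafilter_of_mem hV fun c hc => hc.2
  have hVW : ∀ t, A.Definable L t → (t ∈ V ↔ t ∈ W) := fun t ht =>
    (hVc t ht).symm.trans (hW.realizes_iff.2 hpc t ht)
  refine exists_model_tree (M := M) T φ fun d => ?_
  obtain ⟨f, hf⟩ := exists_isMorleyTree hμ hM hA hVA (hW.isInvariantUltrafilter_iff.2 hp) hVW
    (hWs d) d
  refine ⟨f, fun F hFd => ⟨fun hF hFk => ?_, fun hF hFs => ?_⟩⟩
  · exact ((hf F hFd).1 hF).not_exists_realize hΓ hj hV hVj hFk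
  · exact exists_realize_of_not_kimDivides hW hp hφ ((hf F hFd).2 hF hFs)

theorem hasCTP_of_isBiInvariant (hμ : ℵ₀ ≤ μ) (hM : L.IsSaturated μ M) (hA : #A < μ)
    (hΓ : IsDualType Γ) (hcA : ∃ j, Sum.inr j ∈ BoundedFormula.freeVarFinset φ ∧ c j ∉ A)
    (hc : FinitelySatisfiableIn L A {c' ∈ dualTypeParams Γ φ | ∀ j, c' j ∈ A} c)
    (hpc : p.RealizedOver A c) (hφ : ¬ p.KimDivides A φ) (hp : p.IsBiInvariant A) : T.HasCTP := by
  obtain ⟨k, hk⟩ := hΓ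
  obtain ⟨j, hj, hcj⟩ := hcA
  obtain ⟨W, hW⟩ := exists_represents p
  obtain ⟨𝓜, b, hpath, hcomb⟩ := exists_model_tree_of_isReversible T hμ hM hA hk hj hcj hc hp.1
    hpc hφ hW fun _ : ℕ => isReversible_of_isBiInvariant hμ hM hA hW hp
  refine ⟨k, 𝓜, m, n, φ, b, hpath, fun X hX => ?_⟩
  exact hcomb X (isAntichain_of_isRightComb hX) fun F hFX =>
    Filter.Eventually.of_forall fun _ => (isLeftBounded_one_of_isRightComb hX).mono hFX

theorem hasATP_of_isStronglyBiInvariant (hμ : ℵ₀ ≤ μ) (hM : L.IsSaturated μ M) (hA : #A < μ)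
    (hΓ : IsDualType Γ) (hcA : ∃ j, Sum.inr j ∈ BoundedFormula.freeVarFinset φ ∧ c j ∉ A)
    (hc : FinitelySatisfiableIn L A {c' ∈ dualTypeParams Γ φ | ∀ j, c' j ∈ A} c)
    (hpc : p.RealizedOver A c) (hφ : ¬ p.KimDivides A φ) (hp : p.IsStronglyBiInvariant A) :
    T.HasATP := by
  obtain ⟨k, hk⟩ := hΓ
  obtain ⟨j, hj, hcj⟩ := hcA
  obtain ⟨W, hW⟩ := exists_represents p
  obtain ⟨𝓜, b, hpath, hanti⟩ := exists_model_tree_of_isReversible T hμ hM hA hk hj hcj hc hp.1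
    hpc hφ hW fun d => isReversible_of_isStronglyBiInvariant hμ hM hA hW hp d
  refine ⟨k, 𝓜, m, n, φ, b, hpath, fun X hX => hanti X hX fun F _ => ?_⟩
  exact (Filter.eventually_ge_atTop F.card).mono fun d hd => isLeftBounded_of_card_le hd

theorem exists_mem_club_forall_hasCTP_hasATP {κ : Cardinal.{w}} (hκ : ℵ₀ < κ)
    (hL : lift.{w} L.card < lift.{max u v} κ) (hM : L.IsSaturated κ M) (hΓ : IsDualType Γ)
    {C : Set (L.ElementarySubstructure M)} (hC : IsClubOfSmall κ N C) :
    ∃ N' ∈ C, ∀ (n : ℕ) (φ : L.Formula (Fin m ⊕ Fin n)) (c : Fin n → N)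
      (p : GlobalType L M (Fin n)), φ.plug c ∈ Γ →
      (∃ j, Sum.inr j ∈ BoundedFormula.freeVarFinset φ ∧ (c j : M) ∉ N') →
      p.RealizedOver N' (fun j => (c j : M)) → ¬ p.KimDivides N' φ →
      (p.IsBiInvariant N' → T.HasCTP) ∧ (p.IsStronglyBiInvariant N' → T.HasATP) := by
  have hformulas : lift.{w} #(Σ n, L.Formula (Fin m ⊕ Fin n)) < lift.{max u v} κ :=
    (lift_le.2 (mk_sigma_formula_le L m)).trans_lt <| by
      rw [lift_max, lift_aleph0]
      exact max_lt (aleph0_lt_lift.2 hκ) hL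
  obtain ⟨N', hN', hfs⟩ := exists_mem_club_finitelySatisfiableIn hκ hL hformulas hC
    (P := fun i => dualTypeParams Γ i.2) <| by
      rintro i _ ⟨c, -, rfl⟩ j
      exact (c j).2
  refine ⟨N', hN', fun n φ c p hφΓ hcN' hpc hφ => ?_⟩
  have hc := hfs ⟨n, φ⟩ _ ⟨c, hφΓ, rfl⟩
  exact ⟨hasCTP_of_isBiInvariant T hκ.le hM (hC.small N' hN') hΓ hcN' hc hpc hφ,
    hasATP_of_isStronglyBiInvariant T hκ.le hM (hC.small N' hN') hΓ hcN' hc hpc hφ⟩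

end Trees

end MorleyTree

theorem mainTheorem7_general {L : FirstOrder.Language.{u, v}} (T : L.Theory)
    (κ : Cardinal.{w}) (hκ : ℵ₀ < κ)
    (hTκ : Cardinal.lift.{w} L.card < Cardinal.lift.{max u v} κ)
    (𝕆 : Type w) [L.Structure 𝕆] [Nonempty 𝕆] [𝕆 ⊨ T] (h𝕆 : L.IsSaturated κ 𝕆)
    (M : L.ElementarySubstructure 𝕆)
    (m : ℕ) (Γ : Set (L[[M]].Formula (Fin m))) (hΓ : FirstOrder.Language.IsDualType Γ)
    (C : Set (L.ElementarySubstructure 𝕆)) (hC : FirstOrder.Language.IsClubOfSmall κ M C) :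
    ((∀ N ∈ C, ∃ (n : ℕ) (φ : L.Formula (Fin m ⊕ Fin n)) (c : Fin n → M)
        (p : L.GlobalType 𝕆 (Fin n)),
        φ.plug c ∈ Γ ∧
        (∃ j, Sum.inr j ∈ FirstOrder.Language.BoundedFormula.freeVarFinset φ ∧ (c j : 𝕆) ∉ N) ∧
        p.IsInvariant N ∧ p.RealizedOver N (fun j => (c j : 𝕆)) ∧
        ¬ p.KimDivides N φ ∧ p.IsBiInvariant N) →
      T.HasCTP) ∧
    ((∀ N ∈ C, ∃ (n : ℕ) (φ : L.Formula (Fin m ⊕ Fin n)) (c : Fin n → M)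
        (p : L.GlobalType 𝕆 (Fin n)),
        φ.plug c ∈ Γ ∧
        (∃ j, Sum.inr j ∈ FirstOrder.Language.BoundedFormula.freeVarFinset φ ∧ (c j : 𝕆) ∉ N) ∧
        p.IsInvariant N ∧ p.RealizedOver N (fun j => (c j : 𝕆)) ∧
        ¬ p.KimDivides N φ ∧ p.IsStronglyBiInvariant N) →
      T.HasATP) ∧
    (¬ T.HasATP →
      ∃ N ∈ C, ∀ (n : ℕ) (φ : L.Formula (Fin m ⊕ Fin n)) (c : Fin n → M)
        (p : L.GlobalType 𝕆 (Fin n)),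
        φ.plug c ∈ Γ →
        (∃ j, Sum.inr j ∈ FirstOrder.Language.BoundedFormula.freeVarFinset φ ∧ (c j : 𝕆) ∉ N) →
        p.RealizedOver N (fun j => (c j : 𝕆)) → p.IsStronglyBiInvariant N →
        p.KimDivides N φ) := by
  obtain ⟨N, hN, htree⟩ :=
    MorleyTree.exists_mem_club_forall_hasCTP_hasATP T hκ hTκ h𝕆 hΓ hC
  refine ⟨fun h => ?_, fun h => ?_, fun hT => ⟨N, hN, fun n φ c p hφ hc hpc hp => ?_⟩⟩
  · obtain ⟨n, φ, c, p, hφ, hc, -, hpc, hdiv, hp⟩ := h N hN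
    exact (htree n φ c p hφ hc hpc hdiv).1 hp
  · obtain ⟨n, φ, c, p, hφ, hc, -, hpc, hdiv, hp⟩ := h N hN
    exact (htree n φ c p hφ hc hpc hdiv).2 hp
  · by_contra hdiv
    exact hT ((htree n φ c p hφ hc hpc hdiv).2 hp)

theorem mainTheorem7 {L : FirstOrder.Language.{u, v}} (T : L.Theory) (hT : T.IsComplete)
    -- `κ > |T|` is a measurable cardinal
    (κ : Cardinal.{w}) (hκ : κ.IsMeasurable)
    (hTκ : Cardinal.lift.{w} L.card < Cardinal.lift.{max u v} κ)
    -- `𝕆` is a monster model of `T`, in which `M` (of cardinality `κ`) is small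
    (𝕆 : Type w) [L.Structure 𝕆] [Nonempty 𝕆] [𝕆 ⊨ T]
    (h𝕆 : L.IsSaturated (Order.succ κ) 𝕆)
    -- `M` is the saturated model of `T` of cardinality `κ`
    (M : L.ElementarySubstructure 𝕆) (hMκ : #M = κ) (hM : L.IsSaturated κ M)
    -- `Γ` is a dual type over `M` of cardinality `κ`
    (m : ℕ) (Γ : Set (L[[M]].Formula (Fin m))) (hΓ : FirstOrder.Language.IsDualType Γ)
    (hΓκ : #Γ = Cardinal.lift.{max u v} κ)
    -- `C` is a club of small elementary substructures of `M`
    (C : Set (L.ElementarySubstructure 𝕆)) (hC : FirstOrder.Language.IsClubOfSmall κ M C) :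
    ((∀ N ∈ C, ∃ (n : ℕ) (φ : L.Formula (Fin m ⊕ Fin n)) (c : Fin n → M)
        (p : L.GlobalType 𝕆 (Fin n)),
        φ.plug c ∈ Γ ∧
        (∃ j, Sum.inr j ∈ FirstOrder.Language.BoundedFormula.freeVarFinset φ ∧ (c j : 𝕆) ∉ N) ∧
        p.IsInvariant N ∧ p.RealizedOver N (fun j => (c j : 𝕆)) ∧
        ¬ p.KimDivides N φ ∧ p.IsBiInvariant N) →
      T.HasCTP) ∧
    ((∀ N ∈ C, ∃ (n : ℕ) (φ : L.Formula (Fin m ⊕ Fin n)) (c : Fin n → M)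
        (p : L.GlobalType 𝕆 (Fin n)),
        φ.plug c ∈ Γ ∧
        (∃ j, Sum.inr j ∈ FirstOrder.Language.BoundedFormula.freeVarFinset φ ∧ (c j : 𝕆) ∉ N) ∧
        p.IsInvariant N ∧ p.RealizedOver N (fun j => (c j : 𝕆)) ∧
        ¬ p.KimDivides N φ ∧ p.IsStronglyBiInvariant N) →
      T.HasATP) ∧
    (¬ T.HasATP →
      ∃ N ∈ C, ∀ (n : ℕ) (φ : L.Formula (Fin m ⊕ Fin n)) (c : Fin n → M)
        (p : L.GlobalType 𝕆 (Fin n)),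
        φ.plug c ∈ Γ →
        (∃ j, Sum.inr j ∈ FirstOrder.Language.BoundedFormula.freeVarFinset φ ∧ (c j : 𝕆) ∉ N) →
        p.RealizedOver N (fun j => (c j : 𝕆)) → p.IsStronglyBiInvariant N →
        p.KimDivides N φ) :=
  mainTheorem7_general T κ hκ.1 hTκ 𝕆
    (MorleyTree.isSaturated_mono h𝕆 (Order.le_succ κ)) M m Γ hΓ C hC
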